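/- Let $(S,d)$ be a locally compact, separable, unbounded metric space, let $s>0$, and let $\mu$ be an $s$-Ahlfors regular Borel measure on $S$: there is $C\ge 1$ with $C^{-1}r^s\le\mu(B(x,r))\le C r^s$ for all $x\in S$ and $r>0$, where $B(x,r)=\{y\in S: d(x,y)<r\}$. Let $\rho$ be a probability measure on $(0,\infty)$. For each $\lambda>0$ let $\xi=\xi_\lambda$, defined on a probability space with probability $\mathbb P_\lambda$ and expectation $\mathbb E_\lambda$, be a Poisson point process on $S\times(0,\infty)$ with intensity measure $(\lambda\mu)\otimes\rho$; that is, a random counting measure such that $\xi(A)$ is Poisson distributed with parameter $\lambda\,(\mu\otimes\rho)(A)$ for every Borel set $A$ (with $\xi(A)=\infty$ almost surely if this parameter is $\infty$), and $\xi(A_1),\dots,\xi(A_n)$ are independent for pairwise disjoint Borel sets $A_1,\dots,A_n$. Write $x\leftrightarrow y$ if there is a finite sequence $(z_0,R_0),\dots,(z_n,R_n)$ in $\operatorname{supp}\xi$, $n\ge 0$, with $x\in B(z_0,R_0)$, $y\in B(z_n,R_n)$ and $B(z_{i-1},R_{i-1})\cap B(z_i,R_i)\neq\emptyset$ for $1\le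 i\le n$. Put $M(x)=\sup\{d(x,y): y\in S,\ x\leftrightarrow y\}\in[0,\infty]$, with $\sup\emptyset=0$. (1) The following are equivalent: (a) there exists $\lambda_0>0$ such that for all $\lambda\in(0,\lambda_0)$, $\lim_{r\to\infty}\sup_{x\in S}\mathbb P_\lambda(M(x)>r)=0$; (b) $\int_0^\infty R^s\,\rho(dR)<\infty$. (2) Let $\beta>0$. The following are equivalent: (a) there exists $\lambda_0>0$ such that for all $\lambda\in(0,\lambda_0)$, $\sup_{x\in S}\mathbb E_\lambda[M(x)^\beta]<\infty$; (b) $\int_0^\infty R^{s+\beta}\,\rho(dR)<\infty$. -/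

import Mathlib

open MeasureTheory ProbabilityTheory Filter Topology
open scoped ENNReal NNReal

namespace BooleanPercolation

/-- The Poisson distribution with parameter `t ∈ [0, ∞]`, as a law on `[0, ∞]`; for `t = ∞` it is
the point mass at `∞`. -/
noncomputable def poissonLaw (t : ℝ≥0∞) : Measure ℝ≥0∞ :=
  open Classical in
  if t = ⊤ then Measure.dirac ⊤ else (poissonMeasure t.toNNReal).map (fun n : ℕ => (n : ℝ≥0∞))

/-- A counting measure: a sum of at most countably many unit point masses (repetitions allowed). -/
def IsCountingMeasure {X : Type*} [MeasurableSpace X] (m : Measure X) : Prop :=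
  ∃ (I : Set ℕ) (p : I → X), m = Measure.sum (fun i => Measure.dirac (p i))

/-- `ξ` is a Poisson point process on `X` with intensity measure `ν`, defined on the probability
space `(Ω, P)`. -/
structure IsPoissonPointProcess {Ω X : Type*} [MeasurableSpace Ω] [MeasurableSpace X]
    (ξ : Ω → Measure X) (P : Measure Ω) (ν : Measure X) : Prop where
  isProbabilityMeasure : IsProbabilityMeasure P
  measurable : Measurable ξ
  counting : ∀ ω, IsCountingMeasure (ξ ω)
  law : ∀ A : Set X, MeasurableSet A → HasLaw (fun ω => ξ ω A) (poissonLaw (ν A)) P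
  indep : ∀ (n : ℕ) (A : Fin n → Set X), (∀ i, MeasurableSet (A i)) →
    Pairwise (fun i j => Disjoint (A i) (A j)) → iIndepFun (fun i ω => ξ ω (A i)) P

/-- `μ` is `s`-Ahlfors regular. -/
def IsAhlforsRegular {S : Type*} [MetricSpace S] [MeasurableSpace S] (s : ℝ) (μ : Measure S) :
    Prop :=
  ∃ C : ℝ, 1 ≤ C ∧ ∀ (x : S) (r : ℝ), 0 < r →
    ENNReal.ofReal (C⁻¹ * r ^ s) ≤ μ (Metric.ball x r) ∧
      μ (Metric.ball x r) ≤ ENNReal.ofReal (C * r ^ s)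

/-- The open ball `B(z, R)` of a marked point `(z, R) ∈ S × (0, ∞)`. -/
def grain {S : Type*} [MetricSpace S] (p : S × Set.Ioi (0 : ℝ)) : Set S :=
  Metric.ball p.1 (p.2 : ℝ)

/-- `x` and `y` percolate each other through a chain `z 0, …, z n` of points of `T`
(the support of the point process) with consecutive balls intersecting. -/
def Percolates {S : Type*} [MetricSpace S] (T : Set (S × Set.Ioi (0 : ℝ))) (x y : S) : Prop :=
  ∃ (n : ℕ) (z : ℕ → S × Set.Ioi (0 : ℝ)), (∀ i ≤ n, z i ∈ T) ∧
    (∀ i < n, (grain (z i) ∩ grain (z (i + 1))).Nonempty) ∧ x ∈ grain (z 0) ∧ y ∈ grain (z n)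

/-- The percolation cluster of `x` for the configuration `m`. -/
def cluster {S : Type*} [MetricSpace S] [MeasurableSpace S]
    (m : Measure (S × Set.Ioi (0 : ℝ))) (x : S) : Set S :=
  {y | Percolates m.support x y}

/-- `M(x)`, the supremum in `[0, ∞]` of the distances from `x` to the points of its cluster, with
value `0` if the cluster is empty. -/
noncomputable def clusterRadius {S : Type*} [MetricSpace S] [MeasurableSpace S]
    (m : Measure (S × Set.Ioi (0 : ℝ))) (x : S) : ℝ≥0∞ :=
  ⨆ y ∈ cluster m x, edist x y

end BooleanPercolation

/-!
The proof compares the configuration with itself at the scales `a = 10 ^ n`.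

*Sufficiency.* Say that the configuration crosses at scale `a` around `x` (`Crosses`) if a chain of
balls with centres in `B(x, 10a)` leads from `B(x, a)` to the outside of the ball of radius `8a`. If
there is a crossing at scale `10a`, then either some ball centred in `B(x, 100a)` has radius larger
than `a`, or the chain takes short steps, and both of its ends produce a crossing at scale `a`,
around two points of an `a`-net of `B(x, 100a)` that are far from each other
(`exists_crosses_pair`).
Crossings around far-apart points are independent, since they depend on disjoint parts of the
Poisson process, and Ahlfors regularity bounds the size of the net by a constant `N`. Hence the
supremum `π(a)` over `x` of the crossing probabilities satisfies
`π(10a) ≤ N² π(a)² + const · λ · ∫_{R > a} R ^ s ρ(dR)` (`crossProb_ten_mul_le`). For small `λ` the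
sequence `π(10 ^ n)` starts low enough for this to become a linear recursion with a contraction
factor that is as small as desired (`exists_linear_recursion`). So `π(10 ^ n)` tends to `0`, or is
summable against the weights `10 ^ (β n)`, as soon as the tails `∫_{R > 10 ^ n} R ^ s ρ(dR)` are.
Finally `M(x) > 8a` forces a crossing at scale `a` or a ball that is large compared with `a` and
with its distance to `x` (`mem_farEvent_of_lt_clusterRadius`).

*Necessity.* A ball of radius `R > a` that covers `x` makes `M(x)` at least of order `a`, since it
is too heavy to be contained in a much smaller ball. The number of these balls is Poisson
distributed with a parameter of order `λ ∫_{R > a} R ^ s ρ(dR)`.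

Crossings are treated without a measurability theory of clusters: balls intersect in an open way, so
a crossing is a countable combination of events `ξ U ≠ 0` for basic open `U`
(`measurableSet_voidSigma_chain`), and for such events independence over disjoint sets is immediate
from a π-system argument (`IsPoissonPointProcess.indep_voidSigma`). The radius `M(x)` itself is
compared with measurable events from above and from below.
-/

namespace BooleanPercolation

/-! ### Chains of balls -/

section Deterministic

variable {S : Type*} [MetricSpace S]

/-- The configuration `T` *crosses* at scale `a` around `x`: some chain of intersecting grains of
`T`, all with centres in `B(x, 10a)`, starts at a grain meeting `B(x, a)` and ends at a grain
leaving the closed ball of radius `8a`. The restriction on the centres makes the event depend on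
the points above `B(x, 10a)` only. -/
def Crosses (T : Set (S × Set.Ioi (0 : ℝ))) (x : S) (a : ℝ) : Prop :=
  ∃ (n : ℕ) (z : ℕ → S × Set.Ioi (0 : ℝ)), (∀ i ≤ n, z i ∈ T ∩ {p | dist p.1 x < 10 * a}) ∧
    (∀ i < n, (grain (z i) ∩ grain (z (i + 1))).Nonempty) ∧
    (grain (z 0) ∩ Metric.ball x a).Nonempty ∧
    (grain (z n) ∩ (Metric.closedBall x (8 * a))ᶜ).Nonempty

/-- The marked points of radius larger than `a` whose ball, enlarged by the factor `c`,
contains `x`. -/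
def largeNear (c : ℝ) (x : S) (a : ℝ) : Set (S × Set.Ioi (0 : ℝ)) :=
  {p | dist p.1 x < c * p.2 ∧ a < p.2}

lemma isOpen_largeNear (c : ℝ) (x : S) (a : ℝ) : IsOpen (largeNear c x a) := by
  have h1 : IsOpen {p : S × Set.Ioi (0 : ℝ) | dist p.1 x < c * p.2} :=
    isOpen_lt (by fun_prop) (by fun_prop)
  have h2 : IsOpen {p : S × Set.Ioi (0 : ℝ) | a < p.2} := isOpen_lt (by fun_prop) (by fun_prop)
  exact h1.inter h2

lemma center_mem_grain (p : S × Set.Ioi (0 : ℝ)) : p.1 ∈ grain p :=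
  Metric.mem_ball_self p.2.2

/-- First-exit argument: a chain that leaves `closedBall x (8a)` and meets `B(x, a)` yields a
crossing, unless a grain whose centre lies outside `B(x, 10a)` meets `closedBall x (8a)`. -/
lemma crosses_or_exists_of_chain {T : Set (S × Set.Ioi (0 : ℝ))} {x : S} {a : ℝ} (ha : 0 < a)
    {n : ℕ} {z : ℕ → S × Set.Ioi (0 : ℝ)} (hT : ∀ i ≤ n, z i ∈ T)
    (hz : ∀ i < n, (grain (z i) ∩ grain (z (i + 1))).Nonempty)
    (h0 : (grain (z 0) ∩ Metric.ball x a).Nonempty)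
    (hn : (grain (z n) ∩ (Metric.closedBall x (8 * a))ᶜ).Nonempty) :
    Crosses T x a ∨ ∃ j ≤ n, 10 * a ≤ dist (z j).1 x ∧ dist (z j).1 x < (z j).2 + 8 * a := by
  classical
  have hex : ∃ j, (grain (z j) ∩ (Metric.closedBall x (8 * a))ᶜ).Nonempty := ⟨n, hn⟩
  set j := Nat.find hex with hj
  have hjn : j ≤ n := Nat.find_min' hex hn
  have hjs : (grain (z j) ∩ (Metric.closedBall x (8 * a))ᶜ).Nonempty := Nat.find_spec hex
  have hlt : ∀ i < j, grain (z i) ⊆ Metric.closedBall x (8 * a) := fun i hi => by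
    have := Nat.find_min hex hi
    rwa [← Set.sdiff_eq, Set.not_nonempty_iff_eq_empty, Set.sdiff_eq_empty] at this
  have hc : ∀ i < j, dist (z i).1 x ≤ 8 * a := fun i hi => hlt i hi (center_mem_grain _)
  -- `j` is the first index whose grain leaves the closed ball; all earlier centres stay inside it
  by_cases hd : dist (z j).1 x < 10 * a
  · refine Or.inl ⟨j, z, fun i hi => ⟨hT i (hi.trans hjn), ?_⟩,
      fun i hi => hz i (hi.trans_le hjn), h0, hjs⟩
    rcases hi.lt_or_eq with hi | rfl
    · exact (hc i hi).trans_lt (by linarith)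
    · exact hd
  refine Or.inr ⟨j, hjn, not_lt.1 hd, ?_⟩
  rcases Nat.eq_zero_or_pos j with h | h
  · have h1 : dist (z j).1 x < (z j).2 + a := by
      rw [h]
      exact Metric.dist_lt_add_of_nonempty_ball_inter_ball h0
    linarith
  · have hi : j - 1 < j := Nat.sub_lt h one_pos
    have hmeet := hz (j - 1) (hi.trans_le hjn)
    rw [Nat.sub_add_cancel h] at hmeet
    obtain ⟨w, hw1, hw2⟩ := hmeet
    have h1 : dist w x ≤ 8 * a := hlt _ hi hw1
    have h2 : dist w (z j).1 < (z j).2 := hw2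
    have := dist_triangle_left (z j).1 x w
    linarith

/-- If all radii are at most `a`, then a chain from near `x` that leaves `closedBall x (8a)`
cannot jump over the shell between the radii `8a` and `10a`. -/
lemma crosses_of_chain_of_radius_le {T : Set (S × Set.Ioi (0 : ℝ))} {x : S} {a : ℝ} (ha : 0 < a)
    {n : ℕ} {z : ℕ → S × Set.Ioi (0 : ℝ)} (hT : ∀ i ≤ n, z i ∈ T)
    (hz : ∀ i < n, (grain (z i) ∩ grain (z (i + 1))).Nonempty)
    (hr : ∀ i ≤ n, ((z i).2 : ℝ) ≤ a) (h0 : dist (z 0).1 x < a) (hn : 8 * a < dist (z n).1 x) :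
    Crosses T x a := by
  rcases crosses_or_exists_of_chain ha hT hz ⟨_, center_mem_grain _, h0⟩
    ⟨_, center_mem_grain _, by simpa using hn⟩ with h | ⟨j, hj, h1, h2⟩
  · exact h
  exfalso
  have := hr j hj
  linarith

/-- A cluster reaching beyond distance `8a` comes from a crossing at scale `a` or from a ball that
is large compared with both `a` and its distance to `x`. -/
lemma crosses_or_largeNear_of_percolates {T : Set (S × Set.Ioi (0 : ℝ))} {x y : S} {a : ℝ}
    (ha : 0 < a) (h : Percolates T x y) (hxy : 8 * a < dist x y) :
    Crosses T x a ∨ (T ∩ largeNear 100 x a).Nonempty := by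
  obtain ⟨n, z, hT, hz, hx, hy⟩ := h
  rcases crosses_or_exists_of_chain ha hT hz ⟨x, hx, Metric.mem_ball_self ha⟩
    ⟨y, hy, by simpa [dist_comm] using hxy⟩ with h | ⟨j, hj, h1, h2⟩
  · exact Or.inl h
  · refine Or.inr ⟨z j, hT j hj, ?_, ?_⟩
    · have := (z j).2.2
      simp only [Set.mem_Ioi] at this
      linarith
    · linarith

/-- The scale recursion, deterministic part: a crossing at scale `10a` without large balls contains
crossings at scale `a` around two far-apart points of any `a`-net. -/
lemma exists_crosses_pair {T : Set (S × Set.Ioi (0 : ℝ))} {x : S} {a : ℝ} (ha : 0 < a)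
    (h : Crosses T x (10 * a)) (hl : ¬ (T ∩ largeNear 100 x a).Nonempty)
    {K : Finset S} (hK : ∀ y, dist y x < 100 * a → ∃ k ∈ K, dist y k < a) :
    ∃ k ∈ K, ∃ l ∈ K, 20 * a ≤ dist k l ∧ Crosses T k a ∧ Crosses T l a := by
  obtain ⟨n, z, hT, hz, h0, hn⟩ := h
  have hd : ∀ i ≤ n, dist (z i).1 x < 100 * a := fun i hi => by
    have : dist (z i).1 x < 10 * (10 * a) := (hT i hi).2
    linarith
  have hr : ∀ i ≤ n, ((z i).2 : ℝ) ≤ a := fun i hi => by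
    by_contra hcon
    have := hd i hi
    exact hl ⟨z i, (hT i hi).1, by linarith, by linarith⟩
  obtain ⟨k, hk, hzk⟩ := hK _ (hd 0 n.zero_le)
  obtain ⟨l, hl', hzl⟩ := hK _ (hd n le_rfl)
  have h1 : dist (z 0).1 x < (z 0).2 + 10 * a :=
    Metric.dist_lt_add_of_nonempty_ball_inter_ball h0
  have h2 : 79 * a < dist (z n).1 x := by
    obtain ⟨w, hw1, hw2⟩ := hn
    have hw1 : dist w (z n).1 < (z n).2 := hw1
    have hw2 : 8 * (10 * a) < dist w x := by simpa using hw2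
    have := dist_triangle w (z n).1 x
    have := hr n le_rfl
    linarith
  have h3 := hr 0 n.zero_le
  have h4 : 68 * a < dist (z n).1 (z 0).1 := by
    have := dist_triangle (z n).1 (z 0).1 x
    linarith
  refine ⟨k, hk, l, hl', ?_, ?_, ?_⟩
  · have := dist_triangle4 (z n).1 l k (z 0).1
    rw [dist_comm l k, dist_comm k (z 0).1] at this
    linarith
  · refine crosses_of_chain_of_radius_le ha (fun i hi => (hT i hi).1) hz hr hzk ?_
    have := dist_triangle_right (z n).1 (z 0).1 k
    linarith
  · -- the same chain, run backwards
    refine crosses_of_chain_of_radius_le (n := n) (z := fun i => z (n - i)) ha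
      (fun i _ => (hT _ (n.sub_le i)).1) (fun i hi => ?_) (fun i _ => hr _ (n.sub_le i))
      (by simpa using hzl) ?_
    · have := hz (n - (i + 1)) (by omega)
      rw [show n - (i + 1) + 1 = n - i by omega] at this
      rwa [Set.inter_comm]
    · have := dist_triangle_right (z n).1 (z 0).1 l
      simp only [Nat.sub_self]
      linarith

lemma lt_clusterRadius_iff [MeasurableSpace S] {m : Measure (S × Set.Ioi (0 : ℝ))} {x : S}
    {t : ℝ≥0∞} : t < clusterRadius m x ↔ ∃ y, Percolates m.support x y ∧ t < edist x y := by
  simp [clusterRadius, cluster, lt_iSup_iff]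

end Deterministic

/-! ### Void events of a point process -/

section VoidEvents

variable {Ω X : Type*}

/-- The σ-algebra generated by the events that the random measure `ξ` does not charge `U`, for the
measurable subsets `U` of `A`. -/
@[reducible] def voidSigma [MeasurableSpace X] (ξ : Ω → Measure X) (A : Set X) :
    MeasurableSpace Ω :=
  MeasurableSpace.generateFrom
    {E | ∃ U, MeasurableSet U ∧ U ⊆ A ∧ E = {ω | ξ ω U = 0}}

lemma measurableSet_voidSigma_ne_zero [MeasurableSpace X] {ξ : Ω → Measure X} {A U : Set X}
    (hU : MeasurableSet U) (hUA : U ⊆ A) : MeasurableSet[voidSigma ξ A] {ω | ξ ω U ≠ 0} :=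
  MeasurableSet.compl (MeasurableSpace.measurableSet_generateFrom ⟨U, hU, hUA, rfl⟩)

lemma voidSigma_le [MeasurableSpace Ω] [MeasurableSpace X] {ξ : Ω → Measure X}
    (hξ : Measurable ξ) (A : Set X) : voidSigma ξ A ≤ ‹MeasurableSpace Ω› := by
  refine MeasurableSpace.generateFrom_le ?_
  rintro _ ⟨U, hU, -, rfl⟩
  exact (Measure.measurable_coe hU).comp hξ (measurableSet_singleton 0)

variable [TopologicalSpace X] [SecondCountableTopology X] [MeasurableSpace X]

lemma exists_mem_support_of_ne_zero {m : Measure X} {A : Set X} (h : m A ≠ 0) :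
    (m.support ∩ A).Nonempty := by
  by_contra hcon
  rw [Set.not_nonempty_iff_eq_empty] at hcon
  have hsub : A ⊆ m.supportᶜ := fun x hx hs =>
    Set.notMem_empty x (hcon ▸ (⟨hs, hx⟩ : x ∈ m.support ∩ A))
  exact h (measure_mono_null hsub Measure.measure_compl_support)

lemma ne_zero_iff_exists_mem_support {m : Measure X} {U : Set X} (hU : IsOpen U) :
    (m.support ∩ U).Nonempty ↔ m U ≠ 0 := by
  refine ⟨?_, exists_mem_support_of_ne_zero⟩
  rintro ⟨x, hx, hxU⟩
  exact (((Measure.mem_support_iff_forall x).1 hx) U (hU.mem_nhds hxU)).ne'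

/-- Existence of a chain of support points for an open adjacency relation is a countable
combination of void events: points can be replaced by basic open sets that are charged. -/
lemma measurableSet_voidSigma_chain [OpensMeasurableSpace X] (ξ : Ω → Measure X)
    {Adj : X → X → Prop} (hAdj : IsOpen {p : X × X | Adj p.1 p.2}) {A V : Set X} (hA : IsOpen A)
    (hV : IsOpen V) (n : ℕ) : ∀ U : Set X, IsOpen U → MeasurableSet[voidSigma ξ A]
      {ω | ∃ z : ℕ → X, (∀ i ≤ n, z i ∈ (ξ ω).support ∩ A) ∧ (∀ i < n, Adj (z i) (z (i + 1))) ∧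
        z 0 ∈ V ∧ z n ∈ U} := by
  induction n with
  | zero =>
    intro U hU
    have hO : IsOpen (A ∩ (V ∩ U)) := hA.inter (hV.inter hU)
    convert measurableSet_voidSigma_ne_zero (ξ := ξ) hO.measurableSet Set.inter_subset_left using 1
    ext ω
    rw [Set.mem_ofPred_eq, Set.mem_ofPred_eq, ← ne_zero_iff_exists_mem_support hO]
    constructor
    · rintro ⟨z, h1, -, h3, h4⟩
      exact ⟨z 0, (h1 0 le_rfl).1, (h1 0 le_rfl).2, h3, h4⟩
    · rintro ⟨p, h1, h2, h3, h4⟩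
      exact ⟨fun _ => p, fun _ _ => ⟨h1, h2⟩, by simp, h3, h4⟩
  | succ n ih =>
    intro U hU
    set B := TopologicalSpace.countableBasis X
    have hB := TopologicalSpace.isBasis_countableBasis X
    have hBc : (B ×ˢ B).Countable :=
      (TopologicalSpace.countable_countableBasis X).prod
        (TopologicalSpace.countable_countableBasis X)
    set J : Set (Set X × Set X) := {W | W ∈ B ×ˢ B ∧ ∀ p ∈ W.1, ∀ q ∈ W.2, Adj p q}
    have hJ : J.Countable := hBc.mono fun W hW => hW.1
    have key : ∀ W ∈ J, MeasurableSet[voidSigma ξ A]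
        ({ω | ∃ z : ℕ → X, (∀ i ≤ n, z i ∈ (ξ ω).support ∩ A) ∧
          (∀ i < n, Adj (z i) (z (i + 1))) ∧ z 0 ∈ V ∧ z n ∈ W.1} ∩
          {ω | ξ ω (A ∩ (W.2 ∩ U)) ≠ 0}) := by
      intro W hW
      refine MeasurableSet.inter (ih _ (hB.isOpen hW.1.1)) ?_
      exact measurableSet_voidSigma_ne_zero
        (hA.inter ((hB.isOpen hW.1.2).inter hU)).measurableSet Set.inter_subset_left
    convert MeasurableSet.biUnion hJ key using 1
    ext ω
    simp only [Set.mem_iUnion, Set.mem_inter_iff]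
    constructor
    · rintro ⟨z, h1, h2, h3, h4⟩
      obtain ⟨W₁, W₂, hW₁, hW₂, hz₁, hz₂, hW⟩ :=
        isOpen_prod_iff.1 hAdj (z n) (z (n + 1)) (h2 n n.lt_succ_self)
      obtain ⟨B₁, hB₁, hzB₁, hBW₁⟩ := hB.exists_subset_of_mem_open hz₁ hW₁
      obtain ⟨B₂, hB₂, hzB₂, hBW₂⟩ := hB.exists_subset_of_mem_open hz₂ hW₂
      refine ⟨(B₁, B₂), ⟨⟨hB₁, hB₂⟩, fun p hp q hq => by
          have := @hW (p, q) ⟨hBW₁ hp, hBW₂ hq⟩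
          exact this⟩,
        ⟨z, fun i hi => h1 i (hi.trans n.le_succ), fun i hi => h2 i (hi.trans n.lt_succ_self),
          h3, hzB₁⟩, ?_⟩
      refine (ne_zero_iff_exists_mem_support (hA.inter ((hB.isOpen hB₂).inter hU))).1 ?_
      exact ⟨z (n + 1), (h1 _ le_rfl).1, (h1 _ le_rfl).2, hzB₂, h4⟩
    · rintro ⟨W, hW, ⟨z, h1, h2, h3, h4⟩, h5⟩
      obtain ⟨q, hq, hqA, hqW, hqU⟩ := exists_mem_support_of_ne_zero h5
      refine ⟨fun i => if i ≤ n then z i else q, fun i hi => ?_, fun i hi => ?_, by simpa, by simpa⟩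
      · by_cases hin : i ≤ n
        · simpa only [hin, if_true] using h1 i hin
        · simpa only [hin, if_false] using ⟨hq, hqA⟩
      · rcases (Nat.lt_succ_iff.1 hi).lt_or_eq with hin | rfl
        · simpa [hin.le, Nat.succ_le_of_lt hin] using h2 i hin
        · simpa using hW.2 _ h4 _ hqW

end VoidEvents

/-! ### Poisson void probabilities and independence -/

lemma poissonLaw_singleton_zero {t : ℝ≥0∞} (ht : t ≠ ⊤) :
    poissonLaw t {0} = ENNReal.ofReal (Real.exp (-t.toReal)) := by
  rw [poissonLaw, if_neg ht, Measure.map_apply (by fun_prop) (measurableSet_singleton 0)]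
  have : (fun n : ℕ => (n : ℝ≥0∞)) ⁻¹' {0} = {0} := by ext n; simp
  rw [this, poissonMeasure_singleton]
  simp [ENNReal.coe_toNNReal_eq_toReal]

lemma poissonLaw_top_singleton_zero : poissonLaw ⊤ {0} = 0 := by
  simp [poissonLaw]

namespace IsPoissonPointProcess

variable {Ω X : Type*} [MeasurableSpace Ω] [MeasurableSpace X] {ξ : Ω → Measure X}
  {P : Measure Ω} {ν : Measure X}

lemma measurableSet_ne_zero (h : IsPoissonPointProcess ξ P ν) {A : Set X} (hA : MeasurableSet A) :
    MeasurableSet {ω | ξ ω A ≠ 0} :=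
  ((Measure.measurable_coe hA).comp h.measurable (measurableSet_singleton 0)).compl

lemma measure_ne_zero (h : IsPoissonPointProcess ξ P ν) {A : Set X} (hA : MeasurableSet A) :
    P {ω | ξ ω A ≠ 0} = 1 - poissonLaw (ν A) {0} := by
  have := h.isProbabilityMeasure
  have h0 := (h.law A hA).measure_eq (p := fun t => t = 0) (measurableSet_singleton 0)
  have hm : MeasurableSet {ω | ξ ω A = 0} :=
    (Measure.measurable_coe hA).comp h.measurable (measurableSet_singleton 0)
  change P {ω | ξ ω A = 0}ᶜ = _
  rw [prob_compl_eq_one_sub hm, h0]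
  rfl

lemma measure_ne_zero_eq_one (h : IsPoissonPointProcess ξ P ν) {A : Set X} (hA : MeasurableSet A)
    (ht : ν A = ⊤) : P {ω | ξ ω A ≠ 0} = 1 := by
  rw [h.measure_ne_zero hA, ht, poissonLaw_top_singleton_zero, tsub_zero]

lemma measure_ne_zero_le (h : IsPoissonPointProcess ξ P ν) {A : Set X} (hA : MeasurableSet A) :
    P {ω | ξ ω A ≠ 0} ≤ ν A := by
  by_cases ht : ν A = ⊤
  · simp [ht]
  rw [h.measure_ne_zero hA, poissonLaw_singleton_zero ht, ← ENNReal.ofReal_one,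
    ← ENNReal.ofReal_sub _ (Real.exp_pos _).le]
  refine ENNReal.ofReal_le_of_le_toReal ?_
  have := Real.add_one_le_exp (-(ν A).toReal)
  linarith

/-- On bounded parameters the probability of a nonvoid set is at least a multiple of the
parameter, by `1 - exp (-t) ≥ t * exp (-t)`. -/
lemma mul_exp_le_measure_ne_zero (h : IsPoissonPointProcess ξ P ν) {A : Set X}
    (hA : MeasurableSet A) {t T : ℝ} (ht0 : 0 ≤ t) (htT : t ≤ T)
    (ht : ENNReal.ofReal t ≤ ν A) :
    ENNReal.ofReal (t * Real.exp (-T)) ≤ P {ω | ξ ω A ≠ 0} := by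
  have h1 : t * Real.exp (-T) ≤ 1 - Real.exp (-t) := by
    have h2 : t * Real.exp (-T) ≤ t * Real.exp (-t) := by gcongr
    have h3 := mul_le_mul_of_nonneg_right (Real.add_one_le_exp t) (Real.exp_pos (-t)).le
    rw [← Real.exp_add, add_neg_cancel, Real.exp_zero] at h3
    linarith
  by_cases hν : ν A = ⊤
  · rw [h.measure_ne_zero_eq_one hA hν, ENNReal.ofReal_le_one]
    linarith [Real.exp_pos (-t)]
  rw [h.measure_ne_zero hA, poissonLaw_singleton_zero hν, ← ENNReal.ofReal_one,
    ← ENNReal.ofReal_sub _ (Real.exp_pos _).le]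
  refine ENNReal.ofReal_le_ofReal (h1.trans ?_)
  have h4 : t ≤ (ν A).toReal := (ENNReal.ofReal_le_iff_le_toReal hν).1 ht
  gcongr

/-- Void events over disjoint sets are independent. Void events are stable under intersection,
since `ξ U = 0` and `ξ V = 0` together say `ξ (U ∪ V) = 0`, so that two disjoint sets at a time
suffice. -/
lemma indep_voidSigma (h : IsPoissonPointProcess ξ P ν) {A B : Set X} (hAB : Disjoint A B) :
    Indep (voidSigma ξ A) (voidSigma ξ B) P := by
  have := h.isProbabilityMeasure
  have hm : ∀ C : Set X, ∀ E ∈ {E | ∃ U, MeasurableSet U ∧ U ⊆ C ∧ E = {ω | ξ ω U = 0}},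
      MeasurableSet E := by
    rintro C _ ⟨U, hU, -, rfl⟩
    exact (Measure.measurable_coe hU).comp h.measurable (measurableSet_singleton 0)
  have hpi : ∀ C : Set X,
      IsPiSystem {E | ∃ U, MeasurableSet U ∧ U ⊆ C ∧ E = {ω | ξ ω U = 0}} := by
    rintro C _ ⟨U, hU, hUC, rfl⟩ _ ⟨V, hV, hVC, rfl⟩ -
    refine ⟨U ∪ V, hU.union hV, Set.union_subset hUC hVC, ?_⟩
    ext ω
    simp [measure_union_null_iff]
  refine IndepSets.indep' (hm A) (hm B) (hpi A) (hpi B) ?_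
  rw [IndepSets_iff]
  rintro _ _ ⟨U, hU, hUA, rfl⟩ ⟨V, hV, hVB, rfl⟩
  have hd : Disjoint U V := hAB.mono hUA hVB
  have hi := h.indep 2 ![U, V] (fun i => by fin_cases i <;> assumption) (fun i j hij => by
    fin_cases i <;> fin_cases j
    · exact absurd rfl hij
    · exact hd
    · exact hd.symm
    · exact absurd rfl hij)
  have h01 := hi.indepFun (i := 0) (j := 1) (by decide)
  exact h01.measure_inter_preimage_eq_mul _ _ (measurableSet_singleton 0)
    (measurableSet_singleton 0)

end IsPoissonPointProcess

/-! ### Measurability and independence of crossings -/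

section Crossings

variable {Ω S : Type*} [MetricSpace S] [SecondCountableTopology S] [MeasurableSpace S]
  [BorelSpace S]

lemma measurableSet_voidSigma_crosses (ξ : Ω → Measure (S × Set.Ioi (0 : ℝ))) (x : S) (a : ℝ) :
    MeasurableSet[voidSigma ξ {p | dist p.1 x < 10 * a}] {ω | Crosses (ξ ω).support x a} := by
  have hgrain : ∀ U : Set S, IsOpen {p : S × Set.Ioi (0 : ℝ) | (grain p ∩ U).Nonempty} := by
    intro U
    have : {p : S × Set.Ioi (0 : ℝ) | (grain p ∩ U).Nonempty} =
        ⋃ w ∈ U, {p | dist w p.1 < p.2} := by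
      ext p
      simp [Set.Nonempty, grain, and_comm]
    rw [this]
    exact isOpen_biUnion fun w _ => isOpen_lt (by fun_prop) (by fun_prop)
  have hAdj : IsOpen {p : (S × Set.Ioi (0 : ℝ)) × (S × Set.Ioi (0 : ℝ)) |
      (grain p.1 ∩ grain p.2).Nonempty} := by
    have : {p : (S × Set.Ioi (0 : ℝ)) × (S × Set.Ioi (0 : ℝ)) |
        (grain p.1 ∩ grain p.2).Nonempty} =
        ⋃ w : S, {p | dist w p.1.1 < p.1.2} ∩ {p | dist w p.2.1 < p.2.2} := by
      ext p
      simp [Set.Nonempty, grain]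
    rw [this]
    exact isOpen_iUnion fun w =>
      (isOpen_lt (by fun_prop) (by fun_prop)).inter (isOpen_lt (by fun_prop) (by fun_prop))
  have hA : IsOpen {p : S × Set.Ioi (0 : ℝ) | dist p.1 x < 10 * a} :=
    isOpen_lt (by fun_prop) (by fun_prop)
  have := MeasurableSet.iUnion fun n => measurableSet_voidSigma_chain ξ
    (Adj := fun p q => (grain p ∩ grain q).Nonempty) hAdj hA
    (hgrain (Metric.ball x a)) n _ (hgrain (Metric.closedBall x (8 * a))ᶜ)
  convert this using 1
  ext ω
  simp [Crosses]

variable [MeasurableSpace Ω] {ξ : Ω → Measure (S × Set.Ioi (0 : ℝ))} {P : Measure Ω}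
  {ν : Measure (S × Set.Ioi (0 : ℝ))}

lemma IsPoissonPointProcess.measurableSet_crosses (h : IsPoissonPointProcess ξ P ν) (x : S)
    (a : ℝ) : MeasurableSet {ω | Crosses (ξ ω).support x a} :=
  voidSigma_le h.measurable _ _ (measurableSet_voidSigma_crosses ξ x a)

lemma IsPoissonPointProcess.measure_crosses_inter (h : IsPoissonPointProcess ξ P ν) {k l : S}
    {a : ℝ} (hkl : 20 * a ≤ dist k l) :
    P ({ω | Crosses (ξ ω).support k a} ∩ {ω | Crosses (ξ ω).support l a}) =
      P {ω | Crosses (ξ ω).support k a} * P {ω | Crosses (ξ ω).support l a} := by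
  refine (Indep_iff _ _ _).1 (h.indep_voidSigma ?_) _ _ (measurableSet_voidSigma_crosses ξ k a)
    (measurableSet_voidSigma_crosses ξ l a)
  rw [Set.disjoint_left]
  intro p (hp : dist p.1 k < 10 * a) (hq : dist p.1 l < 10 * a)
  have := dist_triangle_left k l p.1
  linarith

/-- The crossing probabilities, uniformly over the base point. -/
noncomputable def crossProb (ξ : Ω → Measure (S × Set.Ioi (0 : ℝ))) (P : Measure Ω) (a : ℝ) :
    ℝ≥0∞ :=
  ⨆ x : S, P {ω | Crosses (ξ ω).support x a}

end Crossings

/-! ### Geometric scales -/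

section Scales

variable {Ω : Type*}

/-- A power is controlled by the sum of its values at the scales `10 ^ n` that lie below. -/
lemma rpow_le_one_add_tsum_indicator {β : ℝ} (hβ : 0 < β) {t : ℝ≥0∞} {E : ℕ → Set Ω} {ω : Ω}
    (hE : ∀ n, 10 ^ n < t → ω ∈ E n) :
    t ^ β ≤ 1 + 10 ^ β * ∑' n, (E n).indicator (fun _ => ((10 : ℝ≥0∞) ^ β) ^ n) ω := by
  have hw : (1 : ℝ≥0∞) ≤ 10 ^ β := ENNReal.one_le_rpow (by norm_num) hβ
  rcases le_or_gt t 1 with ht | ht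
  · calc t ^ β ≤ 1 := ENNReal.rpow_le_one ht hβ.le
      _ ≤ _ := le_self_add
  -- for `t = ⊤` every term of the series is at least one
  rcases eq_or_ne t ⊤ with rfl | htop
  · have h1 : ∑' n, (E n).indicator (fun _ => ((10 : ℝ≥0∞) ^ β) ^ n) ω = ⊤ := by
      rw [eq_top_iff, ← ENNReal.tsum_const_eq_top_of_ne_zero (α := ℕ) one_ne_zero]
      refine ENNReal.tsum_le_tsum fun n => ?_
      rw [Set.indicator_of_mem (hE n (ENNReal.pow_lt_top (by norm_num)))]
      exact one_le_pow₀ hw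
    rw [h1, ENNReal.mul_top (by positivity)]
    simp
  have hex : ∃ n : ℕ, t ≤ 10 ^ n := by
    lift t to ℝ≥0 using htop
    obtain ⟨n, hn⟩ := pow_unbounded_of_one_lt t (by norm_num : (1 : ℝ≥0) < 10)
    exact ⟨n, by exact_mod_cast hn.le⟩
  classical
  obtain ⟨n, hn⟩ : ∃ n, Nat.find hex = n + 1 := by
    refine Nat.exists_eq_succ_of_ne_zero fun h0 => ?_
    have := Nat.find_spec hex
    rw [h0, pow_zero] at this
    exact absurd this (not_le.2 ht)
  have h1 : t ≤ 10 ^ (n + 1) := hn ▸ Nat.find_spec hex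
  have h2 : (10 : ℝ≥0∞) ^ n < t := not_le.1 (Nat.find_min hex (by omega))
  calc t ^ β ≤ ((10 : ℝ≥0∞) ^ (n + 1)) ^ β := ENNReal.rpow_le_rpow h1 hβ.le
    _ = 10 ^ β * (E n).indicator (fun _ => ((10 : ℝ≥0∞) ^ β) ^ n) ω := by
      rw [Set.indicator_of_mem (hE n h2), ← pow_succ', ← ENNReal.rpow_natCast,
        ← ENNReal.rpow_natCast, ← ENNReal.rpow_mul, ← ENNReal.rpow_mul, mul_comm]
    _ ≤ 10 ^ β * ∑' n, (E n).indicator (fun _ => ((10 : ℝ≥0∞) ^ β) ^ n) ω := by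
      gcongr
      exact ENNReal.le_tsum n
    _ ≤ _ := le_add_self

/-- The sum over the scales `10 ^ n` lying below `t` is geometric, hence of the order of its last
term. -/
lemma exists_tsum_indicator_le_mul_rpow {β : ℝ} (hβ : 0 < β) :
    ∃ c : ℝ≥0∞, c ≠ ⊤ ∧ ∀ {Ω : Type*} {t : ℝ≥0∞} {E : ℕ → Set Ω} {ω : Ω},
      (∀ n, ω ∈ E n → 10 ^ n ≤ t) →
      ∑' n, (E n).indicator (fun _ => ((10 : ℝ≥0∞) ^ β) ^ n) ω ≤ c * t ^ β := by
  have hW : (1 : ℝ) < 10 ^ β := Real.one_lt_rpow (by norm_num) hβ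
  have hw : (10 : ℝ≥0∞) ^ β = ENNReal.ofReal (10 ^ β) := by
    rw [← ENNReal.ofReal_rpow_of_pos (by norm_num)]
    norm_num
  set W : ℝ := 10 ^ β
  refine ⟨ENNReal.ofReal (W / (W - 1)), ENNReal.ofReal_ne_top, fun {Ω t E ω} hE => ?_⟩
  set c := ENNReal.ofReal (W / (W - 1)) with hc
  -- `c = W / (W - 1)` is the fixed point of the recursion for the normalized geometric sums
  have hcw : c + (10 : ℝ≥0∞) ^ β = c * 10 ^ β := by
    rw [hw, hc, ← ENNReal.ofReal_add (div_nonneg (by linarith) (by linarith)) (by linarith),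
      ← ENNReal.ofReal_mul (div_nonneg (by linarith) (by linarith))]
    congr 1
    have : W - 1 ≠ 0 := by linarith
    field_simp
    ring
  have hc1 : 1 ≤ c := by
    rw [hc, ENNReal.one_le_ofReal, le_div_iff₀ (by linarith)]
    linarith
  have hgeom : ∀ N, ∑ n ∈ Finset.range (N + 1), ((10 : ℝ≥0∞) ^ β) ^ n ≤ c * (10 ^ β) ^ N := by
    intro N
    induction N with
    | zero => simpa using hc1
    | succ N ih =>
      rw [Finset.sum_range_succ]
      calc _ ≤ c * (10 ^ β) ^ N + ((10 : ℝ≥0∞) ^ β) ^ (N + 1) := by gcongr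
        _ = (c + 10 ^ β) * (10 ^ β) ^ N := by ring
        _ = c * (10 ^ β) ^ (N + 1) := by rw [hcw]; ring
  refine ENNReal.tsum_le_of_sum_range_le fun N => ?_
  induction N with
  | zero => simp
  | succ N ih =>
    by_cases hN : ω ∈ E N
    · calc _ ≤ ∑ n ∈ Finset.range (N + 1), ((10 : ℝ≥0∞) ^ β) ^ n :=
            Finset.sum_le_sum fun n _ => Set.indicator_le_self (E n) _ ω
        _ ≤ c * (10 ^ β) ^ N := hgeom N
        _ = c * (10 ^ N) ^ β := by
          rw [← ENNReal.rpow_natCast, ← ENNReal.rpow_natCast, ← ENNReal.rpow_mul,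
            ← ENNReal.rpow_mul, mul_comm β]
        _ ≤ c * t ^ β := by
          gcongr
          exact hE N hN
    · rw [Finset.sum_range_succ, Set.indicator_of_notMem hN, add_zero]
      exact ih

/-- A contracting linear recursion passes summability against geometric weights from the
inhomogeneity to the solution. -/
lemma tsum_pow_mul_ne_top_of_recursion {a h : ℕ → ℝ≥0∞} {δ w : ℝ≥0∞} (hw : w ≠ ⊤)
    (hδ : w * δ ≤ 1 / 2) (ha0 : a 0 ≠ ⊤) (ha : ∀ n, a (n + 1) ≤ δ * a n + h n)
    (hh : ∑' n, w ^ n * h n ≠ ⊤) : ∑' n, w ^ n * a n ≠ ⊤ := by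
  set H := ∑' n, w ^ n * h n
  have hB : a 0 + w * H ≠ ⊤ := ENNReal.add_ne_top.2 ⟨ha0, ENNReal.mul_ne_top hw hh⟩
  refine ne_top_of_le_ne_top (ENNReal.mul_ne_top ENNReal.ofNat_ne_top hB : 2 * (a 0 + w * H) ≠ ⊤)
    (ENNReal.tsum_le_of_sum_range_le fun N => ?_)
  induction N with
  | zero => simp
  | succ N ih =>
    rw [Finset.sum_range_succ']
    calc ∑ n ∈ Finset.range N, w ^ (n + 1) * a (n + 1) + w ^ 0 * a 0
        ≤ ∑ n ∈ Finset.range N, (w * δ * (w ^ n * a n) + w * (w ^ n * h n)) + a 0 := by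
          rw [pow_zero, one_mul]
          gcongr with n
          calc w ^ (n + 1) * a (n + 1) ≤ w ^ (n + 1) * (δ * a n + h n) := by gcongr; exact ha n
            _ = _ := by ring
      _ = w * δ * ∑ n ∈ Finset.range N, w ^ n * a n
            + w * ∑ n ∈ Finset.range N, w ^ n * h n + a 0 := by
          rw [Finset.sum_add_distrib, Finset.mul_sum, Finset.mul_sum]
      _ ≤ 1 / 2 * (2 * (a 0 + w * H)) + w * H + a 0 := by
          gcongr
          exact ENNReal.sum_le_tsum _
      _ = 2 * (a 0 + w * H) := by
          rw [← mul_assoc, one_div, ENNReal.inv_mul_cancel (by simp) (by simp)]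
          ring

lemma tendsto_zero_of_recursion {a h : ℕ → ℝ≥0∞} {δ : ℝ≥0∞} (hδ : δ ≤ 1 / 2)
    (ha1 : ∀ n, a n ≤ 1) (ha : ∀ n, a (n + 1) ≤ δ * a n + h n)
    (hh : Tendsto h atTop (𝓝 0)) : Tendsto a atTop (𝓝 0) := by
  have hL1 : limsup a atTop ≤ 1 := limsup_le_of_le (h := Eventually.of_forall ha1)
  have hδ' : δ ≠ ⊤ := ne_top_of_le_ne_top (by simp) hδ
  have hL : limsup a atTop ≤ 1 / 2 * limsup a atTop := by
    calc limsup a atTop = limsup (fun n => a (n + 1)) atTop := (limsup_nat_add a 1).symm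
      _ ≤ limsup (fun n => δ * a n + h n) atTop := limsup_le_limsup (Eventually.of_forall ha)
      _ = δ * limsup a atTop := by
        rw [← Pi.add_def, ENNReal.limsup_add_of_right_tendsto_zero hh,
          ENNReal.limsup_const_mul_of_ne_top hδ']
      _ ≤ _ := by gcongr
  have h0 : limsup a atTop = 0 := by
    by_contra hne
    have h2 : (1 : ℝ≥0∞) ≤ 1 / 2 := by
      refine (ENNReal.mul_le_mul_iff_left hne (ne_top_of_le_ne_top ENNReal.one_ne_top hL1)).1 ?_
      rwa [one_mul]
    norm_num at h2
  exact tendsto_of_le_liminf_of_limsup_le zero_le h0.le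

end Scales

/-! ### Tails of the radius distribution -/

section Tails

/-- The tail `∫_{R > a} R ^ s ρ(dR)` of the `s`-th moment of the radius distribution. -/
noncomputable def radiusTail (ρ : Measure (Set.Ioi (0 : ℝ))) (s a : ℝ) : ℝ≥0∞ :=
  ∫⁻ R in {R | a < (R : ℝ)}, ENNReal.ofReal ((R : ℝ) ^ s) ∂ρ

variable {ρ : Measure (Set.Ioi (0 : ℝ))} {s : ℝ}

lemma measurableSet_lt_radius (a : ℝ) : MeasurableSet {R : Set.Ioi (0 : ℝ) | a < (R : ℝ)} :=
  measurableSet_lt measurable_const measurable_subtype_coe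

lemma radiusTail_le (a : ℝ) : radiusTail ρ s a ≤ ∫⁻ R, ENNReal.ofReal ((R : ℝ) ^ s) ∂ρ :=
  setLIntegral_le_lintegral _ _

lemma lintegral_radius_le [IsProbabilityMeasure ρ] (hs : 0 < s) (a : ℝ) :
    ∫⁻ R, ENNReal.ofReal ((R : ℝ) ^ s) ∂ρ ≤ ENNReal.ofReal (a ^ s) + radiusTail ρ s a := by
  rw [radiusTail, ← lintegral_indicator (measurableSet_lt_radius a)]
  calc _ ≤ ∫⁻ R, (ENNReal.ofReal (a ^ s) + {R : Set.Ioi (0 : ℝ) | a < (R : ℝ)}.indicator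
        (fun R => ENNReal.ofReal ((R : ℝ) ^ s)) R) ∂ρ := by
        refine lintegral_mono fun R => ?_
        have hR : (0 : ℝ) < R := R.2
        by_cases h : a < R
        · rw [Set.indicator_of_mem (by simpa using h)]
          exact le_add_self
        · exact le_add_right (ENNReal.ofReal_le_ofReal
            (Real.rpow_le_rpow hR.le (not_lt.1 h) hs.le))
    _ = _ := by
      rw [lintegral_add_left measurable_const]
      simp

lemma tendsto_radiusTail (h : ∫⁻ R, ENNReal.ofReal ((R : ℝ) ^ s) ∂ρ < ⊤) :
    Tendsto (fun n : ℕ => radiusTail ρ s (10 ^ n)) atTop (𝓝 0) := by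
  simp_rw [radiusTail, ← lintegral_indicator (measurableSet_lt_radius _)]
  rw [← lintegral_zero (μ := ρ)]
  refine tendsto_lintegral_of_dominated_convergence (fun R => ENNReal.ofReal ((R : ℝ) ^ s))
    (fun n => (by fun_prop : Measurable fun R : Set.Ioi (0 : ℝ) =>
      ENNReal.ofReal ((R : ℝ) ^ s)).indicator (measurableSet_lt_radius _))
    (fun n => Eventually.of_forall fun R => Set.indicator_le_self _ _ _) h.ne
    (Eventually.of_forall fun R => ?_)
  refine tendsto_const_nhds.congr' ?_
  have hlim := tendsto_pow_atTop_atTop_of_one_lt (by norm_num : (1 : ℝ) < 10)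
  filter_upwards [hlim.eventually_ge_atTop (R : ℝ)] with n hn
  rw [Set.indicator_of_notMem (by simpa using hn)]

lemma tsum_mul_radiusTail (w : ℝ≥0∞) : ∑' n : ℕ, w ^ n * radiusTail ρ s (10 ^ n) =
    ∫⁻ R, ENNReal.ofReal ((R : ℝ) ^ s) *
      ∑' n : ℕ, {R : Set.Ioi (0 : ℝ) | 10 ^ n < (R : ℝ)}.indicator (fun _ => w ^ n) R ∂ρ := by
  simp_rw [← ENNReal.tsum_mul_left]
  rw [lintegral_tsum]
  swap
  · intro n
    have h1 : Measurable fun R : Set.Ioi (0 : ℝ) => ENNReal.ofReal ((R : ℝ) ^ s) := by fun_prop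
    exact (h1.mul (measurable_const.indicator (measurableSet_lt_radius _))).aemeasurable
  refine tsum_congr fun n => ?_
  rw [radiusTail, ← lintegral_const_mul _ (by fun_prop),
    ← lintegral_indicator (measurableSet_lt_radius _)]
  refine lintegral_congr fun R => ?_
  by_cases h : R ∈ {R : Set.Ioi (0 : ℝ) | 10 ^ n < (R : ℝ)}
  · simp only [Set.indicator_of_mem h, mul_comm]
  · simp only [Set.indicator_of_notMem h, mul_zero]

lemma ofReal_radius_rpow_add {β : ℝ} (R : Set.Ioi (0 : ℝ)) :
    ENNReal.ofReal ((R : ℝ) ^ (s + β)) =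
      ENNReal.ofReal ((R : ℝ) ^ s) * ENNReal.ofReal R ^ β := by
  have hR : (0 : ℝ) < R := R.2
  rw [Real.rpow_add hR, ENNReal.ofReal_mul (by positivity), ENNReal.ofReal_rpow_of_pos hR]

lemma pow_ten_lt_ofReal_iff {n : ℕ} {r : ℝ} : (10 : ℝ≥0∞) ^ n < ENNReal.ofReal r ↔ 10 ^ n < r := by
  rw [show (10 : ℝ≥0∞) ^ n = ENNReal.ofReal (10 ^ n) by
    rw [ENNReal.ofReal_pow (by norm_num)]; norm_num]
  exact ENNReal.ofReal_lt_ofReal_iff_of_nonneg (by positivity)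

/-- Given a finite moment of order `s`, the moment of order `s + β` is finite exactly when the tails
of the former are summable against the weights `10 ^ (β n)`; this is one direction. -/
lemma tsum_mul_radiusTail_ne_top {β : ℝ} (hβ : 0 < β)
    (h : ∫⁻ R, ENNReal.ofReal ((R : ℝ) ^ (s + β)) ∂ρ < ⊤) :
    ∑' n : ℕ, ((10 : ℝ≥0∞) ^ β) ^ n * radiusTail ρ s (10 ^ n) ≠ ⊤ := by
  obtain ⟨c, hc, hle⟩ := exists_tsum_indicator_le_mul_rpow hβ
  rw [tsum_mul_radiusTail]
  refine ne_top_of_le_ne_top (ENNReal.mul_ne_top hc h.ne) ?_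
  rw [← lintegral_const_mul _ (by fun_prop)]
  refine lintegral_mono fun R => ?_
  rw [ofReal_radius_rpow_add, mul_left_comm]
  gcongr
  exact hle fun n hn => (pow_ten_lt_ofReal_iff.2 (by simpa using hn)).le

/-- The converse of `tsum_mul_radiusTail_ne_top`. -/
lemma lintegral_lt_top_of_tsum_mul_radiusTail {β : ℝ} (hβ : 0 < β)
    (hs : ∫⁻ R, ENNReal.ofReal ((R : ℝ) ^ s) ∂ρ ≠ ⊤)
    (h : ∑' n : ℕ, ((10 : ℝ≥0∞) ^ β) ^ n * radiusTail ρ s (10 ^ n) ≠ ⊤) :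
    ∫⁻ R, ENNReal.ofReal ((R : ℝ) ^ (s + β)) ∂ρ < ⊤ := by
  have hw : (10 : ℝ≥0∞) ^ β ≠ ⊤ := ENNReal.rpow_ne_top_of_nonneg hβ.le (by norm_num)
  refine lt_top_iff_ne_top.2
    (ne_top_of_le_ne_top (ENNReal.add_ne_top.2 ⟨hs, ENNReal.mul_ne_top hw h⟩) ?_)
  rw [tsum_mul_radiusTail, ← lintegral_const_mul' _ _ hw, ← lintegral_add_left (by fun_prop)]
  refine lintegral_mono fun R => ?_
  rw [ofReal_radius_rpow_add, mul_left_comm]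
  nth_rewrite 2 [← mul_one (ENNReal.ofReal ((R : ℝ) ^ s))]
  rw [← mul_add]
  gcongr
  exact rpow_le_one_add_tsum_indicator hβ fun n hn => by simpa using pow_ten_lt_ofReal_iff.1 hn

lemma lintegral_radius_lt_top_of_add [IsProbabilityMeasure ρ] (hs : 0 < s) {β : ℝ} (hβ : 0 < β)
    (h : ∫⁻ R, ENNReal.ofReal ((R : ℝ) ^ (s + β)) ∂ρ < ⊤) :
    ∫⁻ R, ENNReal.ofReal ((R : ℝ) ^ s) ∂ρ < ⊤ := by
  have h1 : ∫⁻ R, (1 + ENNReal.ofReal ((R : ℝ) ^ (s + β))) ∂ρ < ⊤ := by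
    rw [lintegral_add_left measurable_const]
    simpa using h
  refine lt_of_le_of_lt (lintegral_mono fun R => ?_) h1
  have hR : (0 : ℝ) < R := R.2
  rcases le_total (R : ℝ) 1 with hR1 | hR1
  · refine le_add_right ?_
    rw [ENNReal.ofReal_le_one]
    exact Real.rpow_le_one hR.le hR1 hs.le
  · exact le_add_left (ENNReal.ofReal_le_ofReal
      (Real.rpow_le_rpow_of_exponent_le hR1 (by linarith)))

end Tails

/-! ### Ahlfors regularity: nets and intensities -/

section Ahlfors

variable {S : Type*} [MetricSpace S] [MeasurableSpace S] {s : ℝ} {μ : Measure S}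

lemma IsAhlforsRegular.isLocallyFiniteMeasure (hμ : IsAhlforsRegular s μ) :
    IsLocallyFiniteMeasure μ := by
  obtain ⟨C, -, h⟩ := hμ
  exact ⟨fun x => ⟨Metric.ball x 1, Metric.ball_mem_nhds x one_pos,
    ((h x 1 one_pos).2).trans_lt ENNReal.ofReal_lt_top⟩⟩

/-- A ball of radius `100a` has an `a`-net whose cardinality is bounded uniformly in the centre and
in `a`, since the volumes of disjoint balls of radius `a / 2` have to fit into a ball of radius
`101a`. -/
lemma IsAhlforsRegular.exists_net [OpensMeasurableSpace S] (hμ : IsAhlforsRegular s μ) :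
    ∃ N : ℕ, ∀ (x : S) (a : ℝ), 0 < a → ∃ K : Finset S, K.card ≤ N ∧
      ∀ y, dist y x < 100 * a → ∃ k ∈ K, dist y k < a := by
  classical
  obtain ⟨C, hC, h⟩ := hμ
  obtain ⟨N, hN⟩ := exists_nat_gt (C * C * 202 ^ s)
  refine ⟨N, fun x a ha => ?_⟩
  have hsep : ∀ K : Finset S, (∀ k ∈ K, dist k x < 100 * a) →
      (∀ k ∈ K, ∀ l ∈ K, k ≠ l → a ≤ dist k l) → K.card ≤ N := by
    intro K hK hKs
    have hdisj : (K : Set S).PairwiseDisjoint fun k => Metric.ball k (a / 2) :=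
      fun k hk l hl hkl => Metric.ball_disjoint_ball (by linarith [hKs k hk l hl hkl])
    have hle : ∑ k ∈ K, μ (Metric.ball k (a / 2)) ≤ μ (Metric.ball x (101 * a)) := by
      rw [← measure_biUnion_finset hdisj fun _ _ => Metric.isOpen_ball.measurableSet]
      refine measure_mono (Set.iUnion₂_subset fun k hk => Metric.ball_subset_ball' ?_)
      linarith [hK k hk]
    have hpos : (0 : ℝ) < (a / 2) ^ s := by positivity
    have h1 : ENNReal.ofReal (K.card * (C⁻¹ * (a / 2) ^ s)) ≤
        ENNReal.ofReal (C * (101 * a) ^ s) := by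
      refine le_trans ?_ (hle.trans (h x _ (by positivity)).2)
      rw [ENNReal.ofReal_mul (by positivity), ENNReal.ofReal_natCast, ← nsmul_eq_mul]
      exact Finset.card_nsmul_le_sum _ _ _ fun k _ => (h k _ (by positivity)).1
    rw [ENNReal.ofReal_le_ofReal_iff (by positivity),
      show 101 * a = 202 * (a / 2) by ring, Real.mul_rpow (by norm_num) (by positivity)] at h1
    have h2 : (K.card : ℝ) ≤ C * C * 202 ^ s := by
      have h3 : (K.card : ℝ) * (C⁻¹ * (a / 2) ^ s) = K.card * C⁻¹ * (a / 2) ^ s := by ring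
      have h4 : C * (202 ^ s * (a / 2) ^ s) = C * 202 ^ s * (a / 2) ^ s := by ring
      rw [h3, h4] at h1
      have h5 := le_of_mul_le_mul_right h1 hpos
      rw [← div_eq_mul_inv, div_le_iff₀ (by positivity)] at h5
      linarith
    exact_mod_cast (h2.trans hN.le)
  -- enlarge separated sets until one of them is a net
  by_contra hcon
  have hgrow : ∀ n : ℕ, ∃ K : Finset S, K.card = n ∧ (∀ k ∈ K, dist k x < 100 * a) ∧
      (∀ k ∈ K, ∀ l ∈ K, k ≠ l → a ≤ dist k l) := by
    intro n
    induction n with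
    | zero => exact ⟨∅, by simp⟩
    | succ n ih =>
      obtain ⟨K, rfl, hK, hKs⟩ := ih
      obtain ⟨y, hy, hyK⟩ : ∃ y, dist y x < 100 * a ∧ ∀ k ∈ K, a ≤ dist y k := by
        by_contra! h'
        exact hcon ⟨K, hsep K hK hKs, h'⟩
      have hyn : y ∉ K := fun hmem => by
        have := hyK y hmem
        rw [dist_self] at this
        linarith
      refine ⟨insert y K, Finset.card_insert_of_notMem hyn, ?_, ?_⟩
      · intro k hk
        rcases Finset.mem_insert.1 hk with rfl | hk
        exacts [hy, hK k hk]
      · intro k hk l hl hkl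
        rcases Finset.mem_insert.1 hk with rfl | hk' <;>
          rcases Finset.mem_insert.1 hl with rfl | hl'
        · exact absurd rfl hkl
        · exact hyK l hl'
        · rw [dist_comm]
          exact hyK k hk'
        · exact hKs k hk' l hl' hkl
  obtain ⟨K, hK1, hK2, hK3⟩ := hgrow (N + 1)
  have := hsep K hK2 hK3
  omega

variable [BorelSpace S] {ρ : Measure (Set.Ioi (0 : ℝ))}

/-- Fubini: the section of `largeNear c x a` at the radius `R > a` is the ball `B(x, cR)`. -/
lemma prod_largeNear [SFinite μ] [SFinite ρ] (l c : ℝ) (x : S) (a : ℝ) :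
    ((ENNReal.ofReal l • μ).prod ρ) (largeNear c x a) =
      ENNReal.ofReal l *
        ∫⁻ R in {R : Set.Ioi (0 : ℝ) | a < R}, μ (Metric.ball x (c * R)) ∂ρ := by
  rw [Measure.prod_apply_symm (isOpen_largeNear c x a).measurableSet,
    ← lintegral_const_mul' _ _ ENNReal.ofReal_ne_top, ← lintegral_indicator
      (measurableSet_lt_radius a)]
  refine lintegral_congr fun R => ?_
  by_cases h : a < R
  · rw [Set.indicator_of_mem (by simpa using h)]
    simp [largeNear, h, Metric.ball]
  · rw [Set.indicator_of_notMem (by simpa using h)]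
    simp [largeNear, h]

lemma prod_largeNear_le [SFinite μ] [SFinite ρ] {C : ℝ} (hC : 0 ≤ C)
    (hμ : ∀ (x : S) (r : ℝ), 0 < r → μ (Metric.ball x r) ≤ ENNReal.ofReal (C * r ^ s))
    {l c : ℝ} (hl : 0 < l) (hc : 0 < c) (x : S) (a : ℝ) :
    ((ENNReal.ofReal l • μ).prod ρ) (largeNear c x a) ≤
      ENNReal.ofReal (l * (C * c ^ s)) * radiusTail ρ s a := by
  rw [prod_largeNear, ENNReal.ofReal_mul hl.le, mul_assoc, radiusTail]
  refine mul_le_mul_right ?_ _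
  rw [← lintegral_const_mul' _ _ ENNReal.ofReal_ne_top]
  refine lintegral_mono fun R => ?_
  have hR : (0 : ℝ) < R := R.2
  refine (hμ x _ (by positivity)).trans_eq ?_
  rw [Real.mul_rpow hc.le hR.le, ← ENNReal.ofReal_mul (by positivity)]
  ring_nf

lemma le_prod_largeNear [SFinite μ] [SFinite ρ] {C : ℝ}
    (hμ : ∀ (x : S) (r : ℝ), 0 < r → ENNReal.ofReal (C⁻¹ * r ^ s) ≤ μ (Metric.ball x r))
    (hC : 0 ≤ C) {l : ℝ} (hl : 0 < l) (x : S) (a : ℝ) :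
    ENNReal.ofReal (l * C⁻¹) * radiusTail ρ s a ≤
      ((ENNReal.ofReal l • μ).prod ρ) (largeNear 1 x a) := by
  rw [prod_largeNear, ENNReal.ofReal_mul hl.le, mul_assoc, radiusTail]
  refine mul_le_mul_right ?_ _
  rw [← lintegral_const_mul' _ _ ENNReal.ofReal_ne_top]
  refine lintegral_mono fun R => ?_
  have hR : (0 : ℝ) < R := R.2
  rw [one_mul, ← ENNReal.ofReal_mul (by positivity)]
  exact hμ x R hR

end Ahlfors

/-! ### The scale recursion -/

section FarEvent

variable {Ω S : Type*} [MetricSpace S] [MeasurableSpace S]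

/-- The event that there is a crossing or a large ball at scale `a` around `x`. It is measurable and
contains the event `M(x) > 8a`. -/
def farEvent (ξ : Ω → Measure (S × Set.Ioi (0 : ℝ))) (x : S) (a : ℝ) : Set Ω :=
  {ω | Crosses (ξ ω).support x a} ∪ {ω | ξ ω (largeNear 100 x a) ≠ 0}

lemma mem_farEvent_of_lt_clusterRadius {ξ : Ω → Measure (S × Set.Ioi (0 : ℝ))} {x : S} {a : ℝ}
    (ha : 0 < a) {ω : Ω} (h : ENNReal.ofReal (8 * a) < clusterRadius (ξ ω) x) :
    ω ∈ farEvent ξ x a := by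
  obtain ⟨y, hxy, hlt⟩ := lt_clusterRadius_iff.1 h
  rw [edist_dist, ENNReal.ofReal_lt_ofReal_iff_of_nonneg (by positivity)] at hlt
  refine (crosses_or_largeNear_of_percolates ha hxy hlt).imp id ?_
  rintro ⟨p, hp, hpl⟩
  exact (((Measure.mem_support_iff_forall p).1 hp) _
    ((isOpen_largeNear 100 x a).mem_nhds hpl)).ne'

lemma IsPoissonPointProcess.crossProb_le_one [MeasurableSpace Ω]
    {ξ : Ω → Measure (S × Set.Ioi (0 : ℝ))} {P : Measure Ω} {ν : Measure (S × Set.Ioi (0 : ℝ))}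
    (h : IsPoissonPointProcess ξ P ν) (a : ℝ) : crossProb ξ P a ≤ 1 := by
  have := h.isProbabilityMeasure
  exact iSup_le fun x => prob_le_one

end FarEvent

section Recursion

variable {Ω S : Type*} [MetricSpace S] [MeasurableSpace S] [BorelSpace S] {s : ℝ} {μ : Measure S}
  {ρ : Measure (Set.Ioi (0 : ℝ))}
  [IsProbabilityMeasure ρ] {C : ℝ} [MeasurableSpace Ω]
  {ξ : Ω → Measure (S × Set.Ioi (0 : ℝ))} {P : Measure Ω}

lemma measure_farEvent_le [SFinite μ] (hC : 0 ≤ C)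
    (hμ : ∀ (x : S) (r : ℝ), 0 < r → μ (Metric.ball x r) ≤ ENNReal.ofReal (C * r ^ s))
    {a l : ℝ} (hl : 0 < l)
    (h : IsPoissonPointProcess ξ P ((ENNReal.ofReal l • μ).prod ρ)) (x : S) :
    P (farEvent ξ x a) ≤ crossProb ξ P a +
      ENNReal.ofReal (l * (C * 100 ^ s)) * radiusTail ρ s a := by
  refine (measure_union_le _ _).trans (add_le_add ?_ ?_)
  · exact le_iSup (fun x : S => P {ω | Crosses (ξ ω).support x a}) x
  · exact (h.measure_ne_zero_le (isOpen_largeNear 100 x a).measurableSet).trans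
      (prod_largeNear_le hC hμ hl (by norm_num) x a)

variable [SecondCountableTopology S]

/-- The quadratic recursion between consecutive scales: two independent crossings at scale `a`, or a
ball of radius larger than `a`. -/
lemma crossProb_ten_mul_le [SFinite μ] (hC : 0 ≤ C)
    (hμ : ∀ (x : S) (r : ℝ), 0 < r → μ (Metric.ball x r) ≤ ENNReal.ofReal (C * r ^ s))
    {N : ℕ} {a l : ℝ} (ha : 0 < a) (hl : 0 < l)
    (hN : ∀ x : S, ∃ K : Finset S, K.card ≤ N ∧ ∀ y, dist y x < 100 * a → ∃ k ∈ K, dist y k < a)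
    (h : IsPoissonPointProcess ξ P ((ENNReal.ofReal l • μ).prod ρ)) :
    crossProb ξ P (10 * a) ≤ (N : ℝ≥0∞) ^ 2 * crossProb ξ P a ^ 2 +
      ENNReal.ofReal (l * (C * 100 ^ s)) * radiusTail ρ s a := by
  classical
  refine iSup_le fun x => ?_
  obtain ⟨K, hKN, hK⟩ := hN x
  set F := (K ×ˢ K).filter fun q => 20 * a ≤ dist q.1 q.2
  have hsub : {ω | Crosses (ξ ω).support x (10 * a)} ⊆
      (⋃ q ∈ F, {ω | Crosses (ξ ω).support q.1 a} ∩ {ω | Crosses (ξ ω).support q.2 a}) ∪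
        {ω | ξ ω (largeNear 100 x a) ≠ 0} := by
    intro ω hω
    by_cases hl : ((ξ ω).support ∩ largeNear 100 x a).Nonempty
    · exact Or.inr ((ne_zero_iff_exists_mem_support (isOpen_largeNear 100 x a)).1 hl)
    · obtain ⟨k, hk, l, hl, hkl, h1, h2⟩ := exists_crosses_pair ha hω hl hK
      refine Or.inl (Set.mem_biUnion (x := (k, l)) ?_ ⟨h1, h2⟩)
      simp [F, hk, hl, hkl]
  calc _ ≤ _ := measure_mono hsub
    _ ≤ _ := measure_union_le _ _
    _ ≤ _ := by
      gcongr
      · calc _ ≤ ∑ q ∈ F, P ({ω | Crosses (ξ ω).support q.1 a} ∩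
              {ω | Crosses (ξ ω).support q.2 a}) := measure_biUnion_finset_le _ _
          _ ≤ ∑ q ∈ F, crossProb ξ P a ^ 2 := by
            refine Finset.sum_le_sum fun q hq => ?_
            rw [h.measure_crosses_inter (Finset.mem_filter.1 hq).2, sq]
            gcongr <;> exact le_iSup (fun x : S => P {ω | Crosses (ξ ω).support x a}) _
          _ = (F.card : ℝ≥0∞) * crossProb ξ P a ^ 2 := by rw [Finset.sum_const, nsmul_eq_mul]
          _ ≤ _ := by
            gcongr
            have h1 : F.card ≤ N ^ 2 := by
              calc F.card ≤ (K ×ˢ K).card := Finset.card_filter_le _ _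
                _ = K.card * K.card := Finset.card_product _ _
                _ ≤ N ^ 2 := by rw [sq]; gcongr
            exact_mod_cast h1
      · exact (h.measure_ne_zero_le (isOpen_largeNear 100 x a).measurableSet).trans
          (prod_largeNear_le hC hμ hl (by norm_num) x a)

/-- A crossing at scale `1` requires at least one centre in `B(x, 10)`. -/
lemma crossProb_one_le
    (hμ : ∀ (x : S) (r : ℝ), 0 < r → μ (Metric.ball x r) ≤ ENNReal.ofReal (C * r ^ s))
    {l : ℝ} (hl : 0 < l)
    (h : IsPoissonPointProcess ξ P ((ENNReal.ofReal l • μ).prod ρ)) :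
    crossProb ξ P 1 ≤ ENNReal.ofReal (l * (C * 10 ^ s)) := by
  refine iSup_le fun x => ?_
  have hO : IsOpen {p : S × Set.Ioi (0 : ℝ) | dist p.1 x < 10} :=
    isOpen_lt (by fun_prop) (by fun_prop)
  have hsub : {ω | Crosses (ξ ω).support x 1} ⊆
      {ω | ξ ω {p : S × Set.Ioi (0 : ℝ) | dist p.1 x < 10} ≠ 0} := by
    rintro ω ⟨n, z, hT, -⟩
    refine (ne_zero_iff_exists_mem_support hO).1 ⟨z 0, (hT 0 n.zero_le).1, ?_⟩
    simpa using (hT 0 n.zero_le).2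
  refine (measure_mono hsub).trans ((h.measure_ne_zero_le hO.measurableSet).trans ?_)
  have : {p : S × Set.Ioi (0 : ℝ) | dist p.1 x < 10} = Metric.ball x 10 ×ˢ Set.univ := by
    ext p
    simp
  rw [this, Measure.prod_prod, measure_univ, mul_one, Measure.smul_apply, smul_eq_mul,
    ENNReal.ofReal_mul hl.le]
  gcongr
  exact hμ x 10 (by norm_num)

lemma measurableSet_farEvent {ν : Measure (S × Set.Ioi (0 : ℝ))}
    (h : IsPoissonPointProcess ξ P ν) (x : S) (a : ℝ) : MeasurableSet (farEvent ξ x a) :=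
  (h.measurableSet_crosses x a).union
    (h.measurableSet_ne_zero (isOpen_largeNear 100 x a).measurableSet)

/-- For small intensities the quadratic recursion starts below its unstable fixed point, so it
becomes a linear recursion with a contraction factor `δ` that is as small as required. -/
lemma exists_linear_recursion [SFinite μ] (hs : 0 < s) (hreg : IsAhlforsRegular s μ)
    (hm : ∫⁻ R, ENNReal.ofReal ((R : ℝ) ^ s) ∂ρ < ⊤) {w : ℝ≥0∞} (hw1 : 1 ≤ w) (hw : w ≠ ⊤) :
    ∃ l₀ : ℝ, 0 < l₀ ∧ ∀ l ∈ Set.Ioo 0 l₀, ∀ {Ω : Type*} [MeasurableSpace Ω]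
      {ξ : Ω → Measure (S × Set.Ioi (0 : ℝ))} {P : Measure Ω},
      IsPoissonPointProcess ξ P ((ENNReal.ofReal l • μ).prod ρ) → ∃ L δ : ℝ≥0∞, L ≠ ⊤ ∧
        δ ≤ 1 / 2 ∧ w * δ ≤ 1 / 2 ∧
        (∀ n : ℕ, crossProb ξ P (10 ^ (n + 1)) ≤
          δ * crossProb ξ P (10 ^ n) + L * radiusTail ρ s (10 ^ n)) ∧
        ∀ (x : S) (n : ℕ), P (farEvent ξ x (10 ^ n)) ≤
          crossProb ξ P (10 ^ n) + L * radiusTail ρ s (10 ^ n) := by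
  obtain ⟨N, hN⟩ := hreg.exists_net
  obtain ⟨C, hC, hb⟩ := hreg
  have hC0 : 0 ≤ C := by linarith
  have hμ := fun (x : S) (r : ℝ) (hr : 0 < r) => (hb x r hr).2
  set m := ∫⁻ R, ENNReal.ofReal ((R : ℝ) ^ s) ∂ρ
  set δ : ℝ≥0∞ := (2 * w)⁻¹ with hδ
  have hw0 : w ≠ 0 := (zero_lt_one.trans_le hw1).ne'
  have hδ1 : w * δ = 1 / 2 := by
    rw [hδ, ENNReal.mul_inv (by simp) (by simp), mul_left_comm, ENNReal.mul_inv_cancel hw0 hw,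
      mul_one, one_div]
  have hδ2 : δ ≤ 1 / 2 := by
    rw [← hδ1]
    exact le_mul_of_one_le_left zero_le hw1
  have hδ0 : δ ≠ 0 := ENNReal.inv_ne_zero.2 (ENNReal.mul_ne_top (by simp) hw)
  -- crossing probabilities at most `e` reproduce themselves from scale to scale
  set e : ℝ≥0∞ := δ / ((N : ℝ≥0∞) ^ 2 + 1) with he
  have he0 : e / 2 ≠ 0 := by
    refine (ENNReal.div_pos (ENNReal.div_pos hδ0 ?_).ne' (by simp)).ne'
    exact ENNReal.add_ne_top.2 ⟨ENNReal.pow_ne_top (ENNReal.natCast_ne_top N), by simp⟩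
  have hNe : (N : ℝ≥0∞) ^ 2 * e ≤ δ :=
    (mul_le_mul_left le_self_add _).trans ENNReal.mul_div_le
  have hlim : Tendsto (fun l : ℝ => ENNReal.ofReal (l * (C * 100 ^ s)) * (1 + m)) (𝓝[>] 0)
      (𝓝 0) := by
    have h1 : Tendsto (fun l : ℝ => ENNReal.ofReal (l * (C * 100 ^ s))) (𝓝[>] 0) (𝓝 0) := by
      have h2 : Continuous fun l : ℝ => ENNReal.ofReal (l * (C * 100 ^ s)) :=
        ENNReal.continuous_ofReal.comp (by fun_prop)
      simpa using (h2.tendsto 0).mono_left nhdsWithin_le_nhds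
    simpa using ENNReal.Tendsto.mul_const h1
      (Or.inr (ENNReal.add_ne_top.2 ⟨ENNReal.one_ne_top, hm.ne⟩))
  obtain ⟨l₀, hl₀, hsmall⟩ := mem_nhdsGT_iff_exists_Ioo_subset.1
    (hlim.eventually_lt_const (pos_iff_ne_zero.2 he0))
  refine ⟨l₀, hl₀, fun l hl {Ω} _ {ξ P} h => ⟨ENNReal.ofReal (l * (C * 100 ^ s)), δ,
    ENNReal.ofReal_ne_top, hδ2, hδ1.le, fun n => ?_,
    fun x n => measure_farEvent_le hC0 hμ hl.1 h x⟩⟩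
  have hL : ENNReal.ofReal (l * (C * 100 ^ s)) * (1 + m) < e / 2 := hsmall hl
  have hrec : ∀ n : ℕ, crossProb ξ P (10 ^ (n + 1)) ≤ (N : ℝ≥0∞) ^ 2 * crossProb ξ P (10 ^ n) ^ 2 +
      ENNReal.ofReal (l * (C * 100 ^ s)) * radiusTail ρ s (10 ^ n) := fun n => by
    have := crossProb_ten_mul_le hC0 hμ (by positivity : (0 : ℝ) < 10 ^ n) hl.1
      (fun x => hN x _ (by positivity)) h
    rwa [← pow_succ'] at this
  have hle : ∀ n : ℕ, crossProb ξ P (10 ^ n) ≤ e := by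
    intro n
    induction n with
    | zero =>
      rw [pow_zero]
      calc _ ≤ ENNReal.ofReal (l * (C * 10 ^ s)) := crossProb_one_le hμ hl.1 h
        _ ≤ ENNReal.ofReal (l * (C * 100 ^ s)) * 1 := by
          rw [mul_one]
          have := hl.1.le
          gcongr
          norm_num
        _ ≤ ENNReal.ofReal (l * (C * 100 ^ s)) * (1 + m) := by gcongr; exact le_self_add
        _ ≤ e := hL.le.trans ENNReal.half_le_self
    | succ n ih =>
      calc _ ≤ _ := hrec n
        _ ≤ (N : ℝ≥0∞) ^ 2 * e ^ 2 + ENNReal.ofReal (l * (C * 100 ^ s)) * (1 + m) := by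
          gcongr
          exact (radiusTail_le _).trans le_add_self
        _ ≤ δ * e + e / 2 := by
          rw [sq e, ← mul_assoc]
          gcongr
        _ ≤ 1 / 2 * e + e / 2 := by gcongr
        _ = e := by rw [one_div, mul_comm, ← div_eq_mul_inv, ENNReal.add_halves]
  calc _ ≤ _ := hrec n
    _ ≤ _ := by
      refine add_le_add ?_ le_rfl
      rw [sq (crossProb _ _ _), ← mul_assoc]
      exact mul_le_mul_left ((mul_le_mul_right (hle n) _).trans hNe) _

end Recursion

/-! ### Necessity of the moment conditions -/

section Necessity

variable {Ω S : Type*} [MetricSpace S] [MeasurableSpace S] {s : ℝ} {μ : Measure S}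

/-- A ball of radius `R > a` covering `x` forces `M(x)` to be at least of order `a`: by Ahlfors
regularity such a ball is too heavy to fit into a ball around `x` of much smaller radius. -/
lemma IsAhlforsRegular.exists_lt_mul_clusterRadius [SecondCountableTopology S] (hs : 0 < s)
    (hμ : IsAhlforsRegular s μ) :
    ∃ c : ℝ, 0 < c ∧ ∀ (m : Measure (S × Set.Ioi (0 : ℝ))) (x : S) (a : ℝ), 0 < a →
      m (largeNear 1 x a) ≠ 0 → ENNReal.ofReal a < ENNReal.ofReal c * clusterRadius m x := by
  obtain ⟨C, hC, h⟩ := hμ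
  have hC0 : 0 < C := by linarith
  -- with this `c`, `C * (2a / c) ^ s = C⁻¹ * a ^ s`, less than the mass of a ball of
  -- radius `R > a`
  refine ⟨2 * (C * C) ^ s⁻¹, by positivity, fun m x a ha hm => ?_⟩
  set c := 2 * (C * C) ^ s⁻¹ with hc
  have hc0 : 0 < c := by positivity
  have hcs : c ^ s = 2 ^ s * (C * C) := by
    rw [hc, Real.mul_rpow (by norm_num) (by positivity), ← Real.rpow_mul (by positivity),
      inv_mul_cancel₀ hs.ne', Real.rpow_one]
  obtain ⟨p, hp, hpx, hpa⟩ := exists_mem_support_of_ne_zero hm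
  rw [one_mul] at hpx
  have hp0 : (0 : ℝ) < p.2 := p.2.2
  obtain ⟨y, hy, hxy⟩ : ∃ y ∈ grain p, a / c < dist x y := by
    by_contra! hcon
    have hsub : Metric.ball p.1 p.2 ⊆ Metric.ball x (2 * a / c) := fun y hy => by
      have h1 : dist x y ≤ a / c := hcon y hy
      have h2 : 0 < a / c := by positivity
      rw [Metric.mem_ball, dist_comm, mul_div_assoc]
      linarith
    have h1 := ((h p.1 p.2 hp0).1.trans (measure_mono hsub)).trans
      (h x (2 * a / c) (by positivity)).2
    rw [ENNReal.ofReal_le_ofReal_iff (by positivity), Real.div_rpow (by positivity) hc0.le, hcs,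
      Real.mul_rpow (by norm_num) ha.le] at h1
    have h2 : a ^ s < (p.2 : ℝ) ^ s := Real.rpow_lt_rpow ha.le hpa hs
    have h3 : C * (2 ^ s * a ^ s / (2 ^ s * (C * C))) = C⁻¹ * a ^ s := by
      have : (2 : ℝ) ^ s ≠ 0 := by positivity
      field_simp
    rw [h3] at h1
    exact absurd (le_of_mul_le_mul_left h1 (by positivity)) (not_le.2 h2)
  have hperc : Percolates m.support x y :=
    ⟨0, fun _ => p, fun _ _ => hp, by simp, by simpa [grain, dist_comm] using hpx, hy⟩
  calc ENNReal.ofReal a < ENNReal.ofReal (c * dist x y) := by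
        rw [ENNReal.ofReal_lt_ofReal_iff_of_nonneg ha.le]
        rwa [div_lt_iff₀' hc0] at hxy
    _ = ENNReal.ofReal c * edist x y := by rw [ENNReal.ofReal_mul hc0.le, edist_dist]
    _ ≤ _ := by
      gcongr
      exact le_iSup₂ (f := fun (y : S) (_ : y ∈ cluster m x) => edist x y) y hperc

variable [BorelSpace S] [MeasurableSpace Ω] {ρ : Measure (Set.Ioi (0 : ℝ))} [IsProbabilityMeasure ρ]
  {ξ : Ω → Measure (S × Set.Ioi (0 : ℝ))} {P : Measure Ω} {l : ℝ}

/-- If the `s`-th moment of the radius is infinite, every point is almost surely covered by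
arbitrarily large balls. -/
lemma measure_largeNear_ne_zero_eq_one [SFinite μ] (hs : 0 < s) (hμ : IsAhlforsRegular s μ)
    (hl : 0 < l) (h : IsPoissonPointProcess ξ P ((ENNReal.ofReal l • μ).prod ρ))
    (hm : ∫⁻ R, ENNReal.ofReal ((R : ℝ) ^ s) ∂ρ = ⊤) (x : S) (a : ℝ) :
    P {ω | ξ ω (largeNear 1 x a) ≠ 0} = 1 := by
  obtain ⟨C, hC, hb⟩ := hμ
  have hC0 : 0 < C := by linarith
  refine h.measure_ne_zero_eq_one (isOpen_largeNear 1 x a).measurableSet ?_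
  have htail : radiusTail ρ s a = ⊤ := by
    have := lintegral_radius_le (ρ := ρ) hs a
    rw [hm, top_le_iff, ENNReal.add_eq_top] at this
    exact this.resolve_left ENNReal.ofReal_ne_top
  have := le_prod_largeNear (ρ := ρ) (fun x r hr => (hb x r hr).1) hC0.le hl x a
  rwa [htail, ENNReal.mul_top (by simpa using by positivity), top_le_iff] at this

variable [SecondCountableTopology S]

/-- With an infinite `s`-th moment, `M(x) > r` would have probability one for every `r`. -/
lemma moment_lt_top_of_tendsto [Nonempty S] [SFinite μ] (hs : 0 < s) (hμ : IsAhlforsRegular s μ)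
    (hl : 0 < l) (h : IsPoissonPointProcess ξ P ((ENNReal.ofReal l • μ).prod ρ))
    (hlim : Tendsto (fun r : ℝ => ⨆ x : S, P {ω | ENNReal.ofReal r < clusterRadius (ξ ω) x})
      atTop (𝓝 0)) :
    ∫⁻ R, ENNReal.ofReal ((R : ℝ) ^ s) ∂ρ < ⊤ := by
  by_contra hcon
  rw [not_lt, top_le_iff] at hcon
  obtain ⟨c, hc, hM⟩ := hμ.exists_lt_mul_clusterRadius hs
  obtain ⟨r, hr1, hr0⟩ :=
    ((hlim.eventually_lt_const zero_lt_one).and (eventually_gt_atTop 0)).exists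
  obtain ⟨x⟩ := ‹Nonempty S›
  refine absurd hr1 (not_lt.2 ?_)
  rw [← measure_largeNear_ne_zero_eq_one hs hμ hl h hcon x (c * r)]
  refine (measure_mono fun ω hω => ?_).trans
    (le_iSup (fun x : S => P {ω | ENNReal.ofReal r < clusterRadius (ξ ω) x}) x)
  have := hM (ξ ω) x (c * r) (by positivity) hω
  rw [ENNReal.ofReal_mul hc.le] at this
  exact lt_of_mul_lt_mul_left' this

/-- The moment of `M(x)` dominates the sum over `n` of `10 ^ (β n)` times the probability that a
ball of radius larger than `10 ^ n` covers `x`. If the `s`-th moment is finite, this probability is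
at least a constant times its tail. -/
lemma moment_add_lt_top_of_lintegral [Nonempty S] [SFinite μ] (hs : 0 < s)
    (hμ : IsAhlforsRegular s μ) (hl : 0 < l)
    (h : IsPoissonPointProcess ξ P ((ENNReal.ofReal l • μ).prod ρ)) {β : ℝ} (hβ : 0 < β)
    (hE : ⨆ x : S, ∫⁻ ω, (clusterRadius (ξ ω) x) ^ β ∂P < ⊤) :
    ∫⁻ R, ENNReal.ofReal ((R : ℝ) ^ (s + β)) ∂ρ < ⊤ := by
  obtain ⟨x⟩ := ‹Nonempty S›
  obtain ⟨c, hc, hM⟩ := hμ.exists_lt_mul_clusterRadius hs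
  obtain ⟨c', hc', hsum⟩ := exists_tsum_indicator_le_mul_rpow hβ
  have hw1 : (1 : ℝ≥0∞) ≤ 10 ^ β := ENNReal.one_le_rpow (by norm_num) hβ
  set w : ℝ≥0∞ := 10 ^ β
  set E : ℕ → Set Ω := fun n => {ω | ξ ω (largeNear 1 x (10 ^ n)) ≠ 0}
  have hEm : ∀ n, MeasurableSet (E n) := fun n =>
    h.measurableSet_ne_zero (isOpen_largeNear 1 x _).measurableSet
  have hfin : ∑' n, w ^ n * P (E n) ≠ ⊤ := by
    have h1 : ∑' n, w ^ n * P (E n) = ∫⁻ ω, ∑' n, (E n).indicator (fun _ => w ^ n) ω ∂P := by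
      rw [lintegral_tsum fun n => (measurable_const.indicator (hEm n)).aemeasurable]
      simp_rw [lintegral_indicator_const (hEm _)]
    have hcβ : c' * ENNReal.ofReal c ^ β ≠ ⊤ :=
      ENNReal.mul_ne_top hc' (ENNReal.rpow_ne_top_of_nonneg hβ.le ENNReal.ofReal_ne_top)
    rw [h1]
    refine ne_top_of_le_ne_top (ENNReal.mul_ne_top hcβ hE.ne) ?_
    calc ∫⁻ ω, ∑' n, (E n).indicator (fun _ => w ^ n) ω ∂P
        ≤ ∫⁻ ω, c' * ENNReal.ofReal c ^ β * clusterRadius (ξ ω) x ^ β ∂P := by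
          refine lintegral_mono fun ω => ?_
          rw [mul_assoc, ← ENNReal.mul_rpow_of_nonneg _ _ hβ.le]
          refine hsum fun n hn => ?_
          have := hM (ξ ω) x (10 ^ n) (by positivity) hn
          rw [ENNReal.ofReal_pow (by norm_num), ENNReal.ofReal_ofNat] at this
          exact this.le
      _ = c' * ENNReal.ofReal c ^ β * ∫⁻ ω, clusterRadius (ξ ω) x ^ β ∂P :=
          lintegral_const_mul' _ _ hcβ
      _ ≤ _ := by
          gcongr
          exact le_iSup (fun x : S => ∫⁻ ω, clusterRadius (ξ ω) x ^ β ∂P) x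
  have hm : ∫⁻ R, ENNReal.ofReal ((R : ℝ) ^ s) ∂ρ ≠ ⊤ := by
    intro htop
    refine hfin (eq_top_iff.2 ?_)
    rw [← ENNReal.tsum_const_eq_top_of_ne_zero (α := ℕ) one_ne_zero]
    refine ENNReal.tsum_le_tsum fun n => ?_
    rw [measure_largeNear_ne_zero_eq_one hs hμ hl h htop x, mul_one]
    exact one_le_pow₀ hw1
  refine lintegral_lt_top_of_tsum_mul_radiusTail hβ hm ?_
  obtain ⟨C, hC, hb⟩ := hμ
  have hC0 : 0 < C := by linarith
  -- all the tails are bounded by the full moment, so one factor `exp (-T)` serves every scale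
  set T := l * C⁻¹ * (∫⁻ R, ENNReal.ofReal ((R : ℝ) ^ s) ∂ρ).toReal
  have hκ : ENNReal.ofReal (l * C⁻¹ * Real.exp (-T)) ≠ 0 := by
    rw [Ne, ENNReal.ofReal_eq_zero, not_le]
    positivity
  have hterm : ∀ n : ℕ, ENNReal.ofReal (l * C⁻¹ * Real.exp (-T)) * radiusTail ρ s (10 ^ n) ≤
      P (E n) := by
    intro n
    have ht : radiusTail ρ s (10 ^ n) ≠ ⊤ := ne_top_of_le_ne_top hm (radiusTail_le _)
    have h1 := h.mul_exp_le_measure_ne_zero (isOpen_largeNear 1 x (10 ^ n)).measurableSet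
      (t := l * C⁻¹ * (radiusTail ρ s (10 ^ n)).toReal) (T := T) (by positivity)
      (mul_le_mul_of_nonneg_left (ENNReal.toReal_mono hm (radiusTail_le _)) (by positivity))
      (by
        rw [ENNReal.ofReal_mul (by positivity), ENNReal.ofReal_toReal ht]
        exact le_prod_largeNear (fun x r hr => (hb x r hr).1) hC0.le hl x _)
    rwa [mul_right_comm, ENNReal.ofReal_mul (by positivity), ENNReal.ofReal_toReal ht] at h1
  intro htop
  refine hfin (eq_top_iff.2 ?_)
  calc ⊤ = ENNReal.ofReal (l * C⁻¹ * Real.exp (-T)) *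
        ∑' n : ℕ, w ^ n * radiusTail ρ s (10 ^ n) := by rw [htop, ENNReal.mul_top hκ]
    _ = ∑' n : ℕ, w ^ n * (ENNReal.ofReal (l * C⁻¹ * Real.exp (-T)) *
        radiusTail ρ s (10 ^ n)) := by
      rw [← ENNReal.tsum_mul_left]
      exact tsum_congr fun n => mul_left_comm _ _ _
    _ ≤ _ := ENNReal.tsum_le_tsum fun n => by gcongr; exact hterm n

end Necessity

/-! ### Sufficiency of the moment conditions -/

section Sufficiency

variable {Ω S : Type*} [MetricSpace S] [MeasurableSpace S]

lemma tendsto_measure_clusterRadius_of_farEvent [MeasurableSpace Ω]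
    {ξ : Ω → Measure (S × Set.Ioi (0 : ℝ))} {P : Measure Ω} {q : ℕ → ℝ≥0∞}
    (hq : Tendsto q atTop (𝓝 0)) (hfar : ∀ (x : S) (n : ℕ), P (farEvent ξ x (10 ^ n)) ≤ q n) :
    Tendsto (fun r : ℝ => ⨆ x : S, P {ω | ENNReal.ofReal r < clusterRadius (ξ ω) x})
      atTop (𝓝 0) := by
  rw [ENNReal.tendsto_nhds_zero]
  intro ε hε
  obtain ⟨n, hn⟩ := ((ENNReal.tendsto_nhds_zero.1 hq) ε hε).exists
  filter_upwards [eventually_ge_atTop (8 * 10 ^ n)] with r hr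
  refine iSup_le fun x => (measure_mono fun ω hω => ?_).trans ((hfar x n).trans hn)
  exact mem_farEvent_of_lt_clusterRadius (by positivity)
    ((ENNReal.ofReal_le_ofReal hr).trans_lt hω)

lemma iSup_lintegral_clusterRadius_lt_top_of_farEvent [MeasurableSpace Ω]
    {ξ : Ω → Measure (S × Set.Ioi (0 : ℝ))} {P : Measure Ω} [IsProbabilityMeasure P]
    {q : ℕ → ℝ≥0∞} {β : ℝ} (hβ : 0 < β) (hq : ∑' n, ((10 : ℝ≥0∞) ^ β) ^ n * q n ≠ ⊤)
    (hm : ∀ (x : S) (n : ℕ), MeasurableSet (farEvent ξ x (10 ^ n)))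
    (hfar : ∀ (x : S) (n : ℕ), P (farEvent ξ x (10 ^ n)) ≤ q n) :
    ⨆ x : S, ∫⁻ ω, (clusterRadius (ξ ω) x) ^ β ∂P < ⊤ := by
  have htop : ∀ t : ℝ≥0∞, t ≠ ⊤ → t ^ β ≠ ⊤ := fun t ht => ENNReal.rpow_ne_top_of_nonneg hβ.le ht
  set w : ℝ≥0∞ := 10 ^ β with hw
  refine lt_of_le_of_lt (b := (8 : ℝ≥0∞) ^ β * (1 + w * ∑' n, w ^ n * q n))
    (iSup_le fun x => ?_) (ENNReal.mul_ne_top (htop _ (by simp)) (ENNReal.add_ne_top.2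
      ⟨ENNReal.one_ne_top, ENNReal.mul_ne_top (htop _ (by simp)) hq⟩)).lt_top
  have hpt : ∀ ω, clusterRadius (ξ ω) x ^ β ≤ 8 ^ β *
      (1 + w * ∑' n, (farEvent ξ x (10 ^ n)).indicator (fun _ => w ^ n) ω) := by
    intro ω
    -- the crossing at scale `10 ^ n` detects distances `8 * 10 ^ n`, whence the division by `8`
    calc clusterRadius (ξ ω) x ^ β = 8 ^ β * (clusterRadius (ξ ω) x / 8) ^ β := by
          rw [← ENNReal.mul_rpow_of_nonneg _ _ hβ.le, ENNReal.mul_div_cancel (by simp) (by simp)]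
      _ ≤ _ := by
          gcongr
          refine rpow_le_one_add_tsum_indicator hβ (E := fun n => farEvent ξ x (10 ^ n))
            fun n hn => ?_
          refine mem_farEvent_of_lt_clusterRadius (by positivity) ?_
          rw [ENNReal.ofReal_mul (by norm_num), ENNReal.ofReal_pow (by norm_num),
            ENNReal.ofReal_ofNat, ENNReal.ofReal_ofNat]
          rw [mul_comm]
          exact (ENNReal.lt_div_iff_mul_lt (by simp) (by simp)).1 hn
  calc _ ≤ _ := lintegral_mono hpt
    _ = 8 ^ β * (1 + w * ∑' n, w ^ n * P (farEvent ξ x (10 ^ n))) := by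
      rw [lintegral_const_mul' _ _ (htop _ (by simp)), lintegral_add_left measurable_const,
        lintegral_const_mul' _ _ (htop _ (by simp)), lintegral_tsum fun n =>
          (measurable_const.indicator (hm x n)).aemeasurable]
      simp_rw [lintegral_indicator_const (hm x _)]
      rw [lintegral_const, measure_univ, mul_one]
    _ ≤ _ := by
      gcongr with n
      exact hfar x n

end Sufficiency

end BooleanPercolation

theorem mainTheorem1 {S : Type*} [MetricSpace S] [LocallyCompactSpace S]
    [TopologicalSpace.SeparableSpace S] [MeasurableSpace S] [BorelSpace S]
    (hunb : ¬ Bornology.IsBounded (Set.univ : Set S))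
    (s : ℝ) (hs : 0 < s) (μ : Measure S) (hμ : BooleanPercolation.IsAhlforsRegular s μ)
    (ρ : Measure (Set.Ioi (0 : ℝ))) [IsProbabilityMeasure ρ]
    {Ω : ℝ → Type*} [∀ l, MeasurableSpace (Ω l)] (P : ∀ l, Measure (Ω l))
    (ξ : ∀ l, Ω l → Measure (S × Set.Ioi (0 : ℝ)))
    (hξ : ∀ l, 0 < l →
      BooleanPercolation.IsPoissonPointProcess (ξ l) (P l) ((ENNReal.ofReal l • μ).prod ρ)) :
    ((∃ l₀ : ℝ, 0 < l₀ ∧ ∀ l ∈ Set.Ioo 0 l₀,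
        Tendsto (fun r : ℝ => ⨆ x : S,
            P l {ω | ENNReal.ofReal r < BooleanPercolation.clusterRadius (ξ l ω) x})
          atTop (𝓝 0)) ↔
      (∫⁻ R, ENNReal.ofReal ((R : ℝ) ^ s) ∂ρ) < ⊤) ∧
    (∀ β : ℝ, 0 < β →
      ((∃ l₀ : ℝ, 0 < l₀ ∧ ∀ l ∈ Set.Ioo 0 l₀,
          (⨆ x : S, ∫⁻ ω, (BooleanPercolation.clusterRadius (ξ l ω) x) ^ β ∂(P l)) < ⊤) ↔
        (∫⁻ R, ENNReal.ofReal ((R : ℝ) ^ (s + β)) ∂ρ) < ⊤)) := by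
  have : SecondCountableTopology S := UniformSpace.secondCountable_of_separable S
  have : IsLocallyFiniteMeasure μ := hμ.isLocallyFiniteMeasure
  have : Nonempty S := by
    by_contra hne
    rw [not_nonempty_iff] at hne
    exact hunb (Set.univ_eq_empty_iff.2 hne ▸ Bornology.isBounded_empty)
  refine ⟨⟨?_, fun hm => ?_⟩, fun β hβ => ⟨?_, fun hmβ => ?_⟩⟩
  · rintro ⟨l₀, hl₀, hlim⟩
    exact BooleanPercolation.moment_lt_top_of_tendsto hs hμ (half_pos hl₀) (hξ _ (half_pos hl₀))
      (hlim _ ⟨half_pos hl₀, half_lt_self hl₀⟩)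
  · obtain ⟨l₀, hl₀, H⟩ := BooleanPercolation.exists_linear_recursion hs hμ hm le_rfl
      ENNReal.one_ne_top
    refine ⟨l₀, hl₀, fun l hl => ?_⟩
    have h := hξ l hl.1
    obtain ⟨L, δ, hL, hδ, -, hrec, hfar⟩ := H l hl h
    have hh : Tendsto (fun n : ℕ => L * BooleanPercolation.radiusTail ρ s (10 ^ n)) atTop
        (𝓝 0) := by
      simpa using ENNReal.Tendsto.const_mul (BooleanPercolation.tendsto_radiusTail hm) (Or.inr hL)
    have hp := BooleanPercolation.tendsto_zero_of_recursion hδ (fun n => h.crossProb_le_one _)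
      hrec hh
    exact BooleanPercolation.tendsto_measure_clusterRadius_of_farEvent
      (by simpa using hp.add hh) hfar
  · rintro ⟨l₀, hl₀, hE⟩
    exact BooleanPercolation.moment_add_lt_top_of_lintegral hs hμ (half_pos hl₀)
      (hξ _ (half_pos hl₀)) hβ (hE _ ⟨half_pos hl₀, half_lt_self hl₀⟩)
  · have hm := BooleanPercolation.lintegral_radius_lt_top_of_add hs hβ hmβ
    have hw : (10 : ℝ≥0∞) ^ β ≠ ⊤ := ENNReal.rpow_ne_top_of_nonneg hβ.le (by simp)
    obtain ⟨l₀, hl₀, H⟩ := BooleanPercolation.exists_linear_recursion hs hμ hm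
      (ENNReal.one_le_rpow (by norm_num) hβ : (1 : ℝ≥0∞) ≤ 10 ^ β) hw
    refine ⟨l₀, hl₀, fun l hl => ?_⟩
    have h := hξ l hl.1
    have := h.isProbabilityMeasure
    obtain ⟨L, δ, hL, -, hδ, hrec, hfar⟩ := H l hl h
    have hh : ∑' n : ℕ, ((10 : ℝ≥0∞) ^ β) ^ n *
        (L * BooleanPercolation.radiusTail ρ s (10 ^ n)) ≠ ⊤ := by
      simp_rw [mul_left_comm _ L]
      rw [ENNReal.tsum_mul_left]
      exact ENNReal.mul_ne_top hL (BooleanPercolation.tsum_mul_radiusTail_ne_top hβ hmβ)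
    have hp := BooleanPercolation.tsum_pow_mul_ne_top_of_recursion hw hδ
      (ne_top_of_le_ne_top ENNReal.one_ne_top (h.crossProb_le_one _)) hrec hh
    refine BooleanPercolation.iSup_lintegral_clusterRadius_lt_top_of_farEvent hβ ?_
      (fun x n => BooleanPercolation.measurableSet_farEvent h x _) hfar
    simp_rw [mul_add]
    rw [ENNReal.tsum_add]
    exact ENNReal.add_ne_top.2 ⟨hp, hh⟩
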